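/- Fix $b>0$, $\alpha>-1$ and $0<r_1<r_2<b^{-1/(2b)}$. For $n\ge 1$ let $Q(z)=|z|^{2b}-\frac{2\alpha}{n}\log|z|$ if $|z|\notin(r_1,r_2)$ and $Q(z)=+\infty$ if $|z|\in(r_1,r_2)$, and let $$K_n(z,w)=e^{-\frac n2Q(z)}e^{-\frac n2Q(w)}\sum_{j=1}^n\frac{z^{j-1}\overline w^{\,j-1}}{h_j},\qquad h_j=\int_{\mathbb C}|z|^{2j-2}e^{-nQ(z)}\,\frac{d^2z}{\pi},$$ be the canonical correlation kernel of the determinantal point process with density proportional to $\prod_{j<k}|z_k-z_j|^2\prod_je^{-nQ(z_j)}$. Put $$\sigma_\star=\frac{r_2^{2b}-r_1^{2b}}{2\log(r_2/r_1)},\quad \sigma_1=\sigma_\star-br_1^{2b},\quad \sigma_2=br_2^{2b}-\sigma_\star,\quad j_\star=n\sigma_\star-\alpha,\quad x=x(n)=j_\star-\lfloor j_\star\rfloor\in[0,1).$$ For $r_1<|z|,|w|<r_2$ let $$\mathcal S^G_{\rm hard}(z,w;n)=\frac1{2\pi}\sum_{\ell=-\infty}^{+\infty}\frac{(z\overline w)^\ell}{\frac{r_1^{2(\ell+1-x)}}{\sigma_1}+\frac{r_2^{2(\ell+1-x)}}{\sigma_2}}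 .$$ Let $t_1,t_2\ge0$ and $\theta_1,\theta_2\in\mathbb R$ with $\theta_1\not\equiv\theta_2 \pmod{2\pi}$ be fixed. Then for every $n$ the Abel limit $$\mathcal S^G_{\rm hard}(r_1e^{i\theta_1},r_1e^{i\theta_2};n):=\lim_{r\searrow r_1}\mathcal S^G_{\rm hard}(re^{i\theta_1},re^{i\theta_2};n)$$ exists and equals $$\frac1{2\pi}\frac{\sigma_1}{r_1^{2(1-x)}}\left(\frac1{e^{i(\theta_1-\theta_2)}-1}+\sum_{\ell=0}^{\infty}\frac{e^{i(\theta_1-\theta_2)\ell}}{1+\frac{\sigma_1}{\sigma_2}(\frac{r_2}{r_1})^{2(\ell+1-x)}}-\sum_{\ell=-\infty}^{-1}\frac{e^{i(\theta_1-\theta_2)\ell}}{1+\frac{\sigma_2}{\sigma_1}(\frac{r_1}{r_2})^{2(\ell+1-x)}}\right).$$ Moreover, with $$z=r_1\Big(1-\frac{t_1}{\sigma_1n}\Big)e^{i\theta_1},\qquad w=r_1\Big(1-\frac{t_2}{\sigma_1n}\Big)e^{i\theta_2},$$ we have, as $n\to\infty$, $$K_n(z,w)=2\pi n\cdot\mathcal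 S^G_{\rm hard}(r_1e^{i\theta_1},r_1e^{i\theta_2};n)\cdot e^{i\lfloor j_\star\rfloor(\theta_1-\theta_2)}\,r_1^{-2x}\,e^{-t_1-t_2}+\mathcal O\big(\sqrt{n\log n}\big),$$ where the implied constant may depend on $b,\alpha,r_1,r_2,t_1,t_2,\theta_1,\theta_2$ but not on $n$. -/

import Mathlib

open Filter Topology Asymptotics MeasureTheory

namespace HardWall

noncomputable section

/-- The total mass `σ_⋆` that the equilibrium measure gives to `{|z| ≤ r₁}`. -/
def sigmaStar (b r₁ r₂ : ℝ) : ℝ :=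
  (r₂ ^ (2 * b) - r₁ ^ (2 * b)) / (2 * Real.log (r₂ / r₁))

/-- The mass `σ₁` swept onto the circle `{|z| = r₁}`. -/
def sigma₁ (b r₁ r₂ : ℝ) : ℝ := sigmaStar b r₁ r₂ - b * r₁ ^ (2 * b)

/-- The mass `σ₂` swept onto the circle `{|z| = r₂}`. -/
def sigma₂ (b r₁ r₂ : ℝ) : ℝ := b * r₂ ^ (2 * b) - sigmaStar b r₁ r₂

/-- `j_⋆ = n σ_⋆ - α`. -/
def jStar (b α r₁ r₂ : ℝ) (n : ℕ) : ℝ := n * sigmaStar b r₁ r₂ - α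

/-- `x = j_⋆ - ⌊j_⋆⌋ ∈ [0,1)`. -/
def xFrac (b α r₁ r₂ : ℝ) (n : ℕ) : ℝ := jStar b α r₁ r₂ n - ⌊jStar b α r₁ r₂ n⌋

/-- The Mittag-Leffler potential with hard wall `G = {r₁ < |z| < r₂}`:
`Q(z) = |z|^{2b} - (2α/n) log |z|` off `G`, and `Q = +∞` on `G`.
(At the origin, a null set, the convention `log 0 = 0` is in force.) -/
def potential (b α r₁ r₂ : ℝ) (n : ℕ) (z : ℂ) : EReal :=
  open scoped Classical in
  if r₁ < ‖z‖ ∧ ‖z‖ < r₂ then ⊤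
  else ((‖z‖ ^ (2 * b) - 2 * α / n * Real.log ‖z‖ : ℝ) : EReal)

/-- The Boltzmann factor `e^{-s Q(z)}`, for real `s > 0`; it vanishes on the wall. -/
def boltzmann (b α r₁ r₂ : ℝ) (n : ℕ) (s : ℝ) (z : ℂ) : ℝ :=
  (EReal.exp (-((s : EReal) * potential b α r₁ r₂ n z))).toReal

/-- The squared norm `h_j = ∫_ℂ |z|^{2j-2} e^{-nQ(z)} d²z/π`, for `j ≥ 1`. -/
def normSq (b α r₁ r₂ : ℝ) (n j : ℕ) : ℝ :=
  (∫ z : ℂ, ‖z‖ ^ (2 * (j - 1)) * boltzmann b α r₁ r₂ n n z) / Real.pi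

/-- The canonical correlation kernel
`K_n(z,w) = e^{-nQ(z)/2} e^{-nQ(w)/2} ∑_{j=1}^n z^{j-1} w̄^{j-1} / h_j`. -/
def kernel (b α r₁ r₂ : ℝ) (n : ℕ) (z w : ℂ) : ℂ :=
  (boltzmann b α r₁ r₂ n (n / 2) z : ℂ) * (boltzmann b α r₁ r₂ n (n / 2) w : ℂ) *
    ∑ j ∈ Finset.Icc 1 n,
      z ^ (j - 1) * (starRingEnd ℂ w) ^ (j - 1) / (normSq b α r₁ r₂ n j : ℂ)

/-- The oscillatory Szegő kernel of the annulus `G = {r₁ < |z| < r₂}`, as a bilateral series. -/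
def szego (b α r₁ r₂ : ℝ) (n : ℕ) (z w : ℂ) : ℂ :=
  1 / (2 * Real.pi) * ∑' l : ℤ, (z * starRingEnd ℂ w) ^ l /
    ((r₁ ^ (2 * ((l : ℝ) + 1 - xFrac b α r₁ r₂ n)) / sigma₁ b r₁ r₂
      + r₂ ^ (2 * ((l : ℝ) + 1 - xFrac b α r₁ r₂ n)) / sigma₂ b r₁ r₂ : ℝ) : ℂ)

/-- The regularized oscillatory Szegő kernel at the pair of boundary points
`r₁ e^{iθ₁}`, `r₁ e^{iθ₂}`: the Abel limit, as `r ↘ r₁`, of the oscillatory Szegő kernel at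
`r e^{iθ₁}`, `r e^{iθ₂}`. -/
def szegoReg (b α r₁ r₂ : ℝ) (n : ℕ) (θ₁ θ₂ : ℝ) : ℂ :=
  limUnder (𝓝[>] r₁) fun r : ℝ =>
    szego b α r₁ r₂ n (r * Complex.exp (Complex.I * θ₁)) (r * Complex.exp (Complex.I * θ₂))

end

end HardWall

/-! Polar coordinates and the substitutions `v = r₁ e^{-s/2}`, `v = r₂ e^{s/2}` turn each `h_j` into
an explicit prefactor times `innerLaplace + (r₂/r₁)^{2(j-j⋆)} outerLaplace` (`normSq_eq`). Near `j⋆`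
the two integrals are `1/(σ₁n)` and `1/(σ₂n)` up to a relative error `O((1+|j-j⋆|)/n)`. Hence, with
`N = ⌊j⋆⌋`, `j = N+1+l` and `κ = (r₂/r₁)²`, the normalised reciprocals look like `1/(1 + c κ^l)`,
which are the coefficients of the Szegő series.

For `l ≥ 0` these coefficients decay geometrically, so only a window around `j⋆` matters
(`upper_sum_le`). For `l < 0` they tend to `1`, and the sum runs over order `n` oscillating terms,
most of them far from the window. There one writes `1/(g+v) = 1/g - v/(g(g+v))`. The second piece
again decays geometrically and gives `negativeTail` (`lower_sum_le`). The first is summed by parts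
twice: the reciprocal inner moments are increasing, grow at most linearly, and are convex along unit
steps (`inv_innerLaplace_convex`), so after division by `σ₁n` only the boundary term `ω^N/(ζ-1)`
survives, up to `O(1/n)` (`geometric_part`). The same `1/(ζ-1)` appears when the bilateral series is
continued to its boundary circle (`bilateral_abel`).

At depth `t/(σ₁n)` the Boltzmann factor and the power `(1-τ)^N` combine to `e^{-t}`
(`radialFactor_asymp`). All normalised errors are `O(1/n)` and the kernel carries a factor `n`, so
the error is in fact bounded, which is stronger than `O(√(n log n))`. -/

namespace HardWall

/-! ### Two-sided bounds for the radial Laplace integrals. -/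

/-- The normalised inner moment integral in the variable `s = -2 log (v / r₁)`. -/
noncomputable def innerLaplace (b R p : ℝ) : ℝ :=
  ∫ s in Set.Ioi (0 : ℝ), Real.exp (-(p * s) + R * (1 - Real.exp (-(b * s))))

/-- The normalised outer moment integral in the variable `s = 2 log (v / r₂)`. -/
noncomputable def outerLaplace (b R p : ℝ) : ℝ :=
  ∫ s in Set.Ioi (0 : ℝ), Real.exp (p * s - R * (Real.exp (b * s) - 1))

lemma integrableOn_exp_neg_mul {m : ℝ} (hm : 0 < m) :
    IntegrableOn (fun s : ℝ => Real.exp (-(m * s))) (Set.Ioi 0) := by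
  have := integrableOn_exp_mul_Ioi (a := -m) (by linarith) 0
  simpa [neg_mul] using this

lemma integral_exp_neg_mul {m : ℝ} (hm : 0 < m) :
    ∫ s in Set.Ioi (0 : ℝ), Real.exp (-(m * s)) = 1 / m := by
  have := integral_exp_mul_Ioi (a := -m) (by linarith) 0
  simp only [neg_mul, mul_zero, Real.exp_zero] at this
  rw [this]; field_simp

lemma integral_sq_mul_exp_neg_mul {m : ℝ} (hm : 0 < m) :
    ∫ s in Set.Ioi (0 : ℝ), s ^ 2 * Real.exp (-(m * s)) = 2 / m ^ 3 := by
  have := Real.integral_rpow_mul_exp_neg_mul_Ioi (a := 3) (by norm_num) hm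
  have h3 : Real.Gamma 3 = 2 := by
    have := Real.Gamma_nat_eq_factorial 2
    norm_num [Nat.factorial] at this ⊢
  rw [h3] at this
  norm_num at this
  rw [this]
  field_simp

lemma integrableOn_sq_mul_exp_neg_mul {m : ℝ} (hm : 0 < m) :
    IntegrableOn (fun s : ℝ => s ^ 2 * Real.exp (-(m * s))) (Set.Ioi 0) := by
  -- A non-integrable function has Bochner integral `0`, contradicting the positive value just
  -- computed.
  by_contra h
  have h1 := integral_sq_mul_exp_neg_mul hm
  rw [integral_undef h] at h1
  have : 0 < 2 / m ^ 3 := by positivity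
  linarith

lemma innerLaplace_integrableOn {b R p : ℝ} (hR : 0 ≤ R) (hp : 0 < p) :
    IntegrableOn (fun s : ℝ => Real.exp (-(p * s) + R * (1 - Real.exp (-(b * s)))))
      (Set.Ioi 0) := by
  refine Integrable.mono' ((integrableOn_exp_neg_mul hp).mul_const (Real.exp R))
    (by fun_prop) ?_
  refine (ae_restrict_iff' measurableSet_Ioi).2 (Eventually.of_forall fun s hs => ?_)
  rw [Real.norm_of_nonneg (Real.exp_pos _).le, ← Real.exp_add]
  apply Real.exp_le_exp.2
  nlinarith [Real.exp_pos (-(b * s))]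

lemma outerLaplace_integrableOn {b R p : ℝ} (hb : 0 < b) (hR : 0 < R) :
    IntegrableOn (fun s : ℝ => Real.exp (p * s - R * (Real.exp (b * s) - 1)))
      (Set.Ioi 0) := by
  -- The constant is the exponential of the maximum over `s` of `(p+1)s - R(bs)²/2`; the extra `1`
  -- leaves an integrable `e^{-s}`.
  refine Integrable.mono' ((integrableOn_exp_neg_mul one_pos).const_mul
    (Real.exp ((p + 1) ^ 2 / (2 * R * b ^ 2)))) (by fun_prop) ?_
  refine (ae_restrict_iff' measurableSet_Ioi).2 (Eventually.of_forall fun s hs => ?_)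
  have hs : 0 < s := hs
  rw [Real.norm_of_nonneg (Real.exp_pos _).le, ← Real.exp_add]
  apply Real.exp_le_exp.2
  have h1 := Real.quadratic_le_exp_of_nonneg (x := b * s) (by positivity)
  have h2 : (b * s) ^ 2 / 2 ≤ Real.exp (b * s) - 1 := by nlinarith [mul_pos hb hs]
  have h3 : R * ((b * s) ^ 2 / 2) ≤ R * (Real.exp (b * s) - 1) := by gcongr
  have h4 : (p + 1) * s - R * ((b * s) ^ 2 / 2) ≤ (p + 1) ^ 2 / (2 * R * b ^ 2) := by
    rw [le_div_iff₀ (by positivity)]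
    nlinarith [sq_nonneg ((p + 1) - R * b ^ 2 * s)]
  linarith

/-- Linearising `1 - e^{-bs} ≤ bs` leaves a pure exponential of rate `p - bR`. -/
lemma innerLaplace_le {b R p : ℝ} (hb : 0 < b) (hR : 0 ≤ R) (hp : b * R < p) :
    innerLaplace b R p ≤ 1 / (p - b * R) := by
  have hm : 0 < p - b * R := by linarith
  rw [← integral_exp_neg_mul hm]
  refine setIntegral_mono_on (innerLaplace_integrableOn hR (by nlinarith))
    (integrableOn_exp_neg_mul hm) measurableSet_Ioi fun s hs => ?_
  apply Real.exp_le_exp.2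
  nlinarith [Real.add_one_le_exp (-(b * s))]

lemma exp_neg_le_quadratic {y : ℝ} (hy : 0 ≤ y) : Real.exp (-y) ≤ 1 - y + y ^ 2 / 2 := by
  have h := Real.quadratic_le_exp_of_nonneg hy
  have h1 : Real.exp (-y) * Real.exp y = 1 := by rw [← Real.exp_add]; simp
  have h2 : 0 < 1 - y + y ^ 2 / 2 := by nlinarith [sq_nonneg (y - 1)]
  have h3 : 1 ≤ (1 - y + y ^ 2 / 2) * Real.exp y := by
    calc (1 : ℝ) ≤ (1 - y + y ^ 2 / 2) * (1 + y + y ^ 2 / 2) := by nlinarith [sq_nonneg (y ^ 2)]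
      _ ≤ _ := by gcongr
  nlinarith [Real.exp_pos y]

/-- Keeping the quadratic Taylor term costs a factor at least `1 - R b² s²/2`. When `R` and `p - bR`
are of order `n`, the correction is smaller than the main term by a factor `1/n`. -/
lemma innerLaplace_ge {b R p : ℝ} (hb : 0 < b) (hR : 0 ≤ R) (hp : b * R < p) :
    1 / (p - b * R) - R * b ^ 2 / (p - b * R) ^ 3 ≤ innerLaplace b R p := by
  have hm : 0 < p - b * R := by linarith
  have h1 : 1 / (p - b * R) - R * b ^ 2 / (p - b * R) ^ 3 =
      ∫ s in Set.Ioi (0 : ℝ), (Real.exp (-((p - b * R) * s))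
        - R * b ^ 2 / 2 * (s ^ 2 * Real.exp (-((p - b * R) * s)))) := by
    rw [integral_sub (integrableOn_exp_neg_mul hm)
      ((integrableOn_sq_mul_exp_neg_mul hm).const_mul _), integral_const_mul,
      integral_exp_neg_mul hm, integral_sq_mul_exp_neg_mul hm]
    ring
  rw [h1]
  refine setIntegral_mono_on ((integrableOn_exp_neg_mul hm).sub
    ((integrableOn_sq_mul_exp_neg_mul hm).const_mul _))
    (innerLaplace_integrableOn hR (by nlinarith)) measurableSet_Ioi fun s hs => ?_
  have hs : 0 < s := hs
  have h2 := exp_neg_le_quadratic (y := b * s) (by positivity)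
  have h3 : Real.exp (-((p - b * R) * s) - R * b ^ 2 / 2 * s ^ 2) ≤
      Real.exp (-(p * s) + R * (1 - Real.exp (-(b * s)))) := by
    apply Real.exp_le_exp.2; nlinarith
  refine le_trans ?_ h3
  rw [sub_eq_add_neg _ (R * b ^ 2 / 2 * s ^ 2), Real.exp_add]
  nlinarith [Real.add_one_le_exp (-(R * b ^ 2 / 2 * s ^ 2)), Real.exp_pos (-((p - b * R) * s))]

/-- Cruder than `innerLaplace_ge`, but available for every `p > 0`, including `p ≤ bR`, which is
needed for indices far below the critical one. -/
lemma one_div_le_innerLaplace {b R p : ℝ} (hb : 0 < b) (hR : 0 ≤ R) (hp : 0 < p) :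
    1 / p ≤ innerLaplace b R p := by
  rw [← integral_exp_neg_mul hp]
  refine setIntegral_mono_on (integrableOn_exp_neg_mul hp)
    (innerLaplace_integrableOn hR hp) measurableSet_Ioi fun s hs => ?_
  have hs : 0 < s := hs
  apply Real.exp_le_exp.2
  have : Real.exp (-(b * s)) ≤ 1 := Real.exp_le_one_iff.2 (by nlinarith)
  nlinarith

lemma innerLaplace_pos {b R p : ℝ} (hb : 0 < b) (hR : 0 ≤ R) (hp : 0 < p) :
    0 < innerLaplace b R p :=
  (one_div_pos.2 hp).trans_le (one_div_le_innerLaplace hb hR hp)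

lemma innerLaplace_anti {b R p p' : ℝ} (hR : 0 ≤ R) (hp : 0 < p) (h : p ≤ p') :
    innerLaplace b R p' ≤ innerLaplace b R p := by
  refine setIntegral_mono_on (innerLaplace_integrableOn hR (hp.trans_le h))
    (innerLaplace_integrableOn hR hp) measurableSet_Ioi fun s hs => ?_
  have hs : 0 < s := hs
  apply Real.exp_le_exp.2
  nlinarith

lemma outerLaplace_le {b R p : ℝ} (hb : 0 < b) (hR : 0 < R) (hp : p < b * R) :
    outerLaplace b R p ≤ 1 / (b * R - p) := by
  have hm : 0 < b * R - p := by linarith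
  rw [← integral_exp_neg_mul hm]
  refine setIntegral_mono_on (outerLaplace_integrableOn hb hR)
    (integrableOn_exp_neg_mul hm) measurableSet_Ioi fun s hs => ?_
  apply Real.exp_le_exp.2
  nlinarith [Real.add_one_le_exp (b * s)]

lemma exp_le_quadratic {y : ℝ} (hy : 0 ≤ y) : Real.exp y ≤ 1 + y + y ^ 2 * Real.exp y := by
  have h := Real.quadratic_le_exp_of_nonneg hy
  have h2 := Real.add_one_le_exp (-y)
  have h1 : Real.exp (-y) * Real.exp y = 1 := by rw [← Real.exp_add]; simp
  have h3 : Real.exp y * (1 - y) ≤ 1 := by nlinarith [Real.exp_pos y]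
  nlinarith [Real.exp_pos y]

/-- The quadratic Taylor bound for `e^{bs}` has a constant only on `s ≤ 1`. The assumption on `R`
makes the minorant nonpositive for `s > 1`, where nothing remains to be proved. -/
lemma outerLaplace_ge {b R p : ℝ} (hb : 0 < b) (hR : 1 ≤ R * (b ^ 2 * Real.exp b))
    (hp : p < b * R) :
    1 / (b * R - p) - 2 * R * (b ^ 2 * Real.exp b) / (b * R - p) ^ 3 ≤ outerLaplace b R p := by
  have hm : 0 < b * R - p := by linarith
  have hR0 : 0 < R := by
    by_contra h
    have : 0 < b ^ 2 * Real.exp b := by positivity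
    nlinarith
  have h1 : 1 / (b * R - p) - 2 * R * (b ^ 2 * Real.exp b) / (b * R - p) ^ 3 =
      ∫ s in Set.Ioi (0 : ℝ), (Real.exp (-((b * R - p) * s))
        - R * (b ^ 2 * Real.exp b) * (s ^ 2 * Real.exp (-((b * R - p) * s)))) := by
    rw [integral_sub (integrableOn_exp_neg_mul hm)
      ((integrableOn_sq_mul_exp_neg_mul hm).const_mul _), integral_const_mul,
      integral_exp_neg_mul hm, integral_sq_mul_exp_neg_mul hm]
    ring
  rw [h1]
  refine setIntegral_mono_on ((integrableOn_exp_neg_mul hm).sub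
    ((integrableOn_sq_mul_exp_neg_mul hm).const_mul _))
    (outerLaplace_integrableOn hb hR0) measurableSet_Ioi fun s hs => ?_
  have hs : 0 < s := hs
  have hE := Real.exp_pos (-((b * R - p) * s))
  rcases le_or_gt s 1 with h | h
  · have h2 := exp_le_quadratic (y := b * s) (by positivity)
    have h2' : Real.exp (b * s) ≤ Real.exp b := Real.exp_le_exp.2 (by nlinarith)
    have h2'' : (b * s) ^ 2 * Real.exp (b * s) ≤ (b * s) ^ 2 * Real.exp b := by gcongr
    have h3 : Real.exp (-((b * R - p) * s) - R * (b ^ 2 * Real.exp b) * s ^ 2) ≤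
        Real.exp (p * s - R * (Real.exp (b * s) - 1)) := by
      apply Real.exp_le_exp.2
      have : R * (Real.exp (b * s) - 1) ≤ R * (b * s + (b * s) ^ 2 * Real.exp b) := by
        gcongr; linarith
      nlinarith
    refine le_trans ?_ h3
    rw [sub_eq_add_neg _ (R * (b ^ 2 * Real.exp b) * s ^ 2), Real.exp_add]
    nlinarith [Real.add_one_le_exp (-(R * (b ^ 2 * Real.exp b) * s ^ 2))]
  · have : 1 ≤ R * (b ^ 2 * Real.exp b) * s ^ 2 := by nlinarith
    have h5 := Real.exp_pos (p * s - R * (Real.exp (b * s) - 1))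
    nlinarith

lemma outerLaplace_mono {b R p p' : ℝ} (hb : 0 < b) (hR : 0 < R) (h : p ≤ p') :
    outerLaplace b R p ≤ outerLaplace b R p' := by
  refine setIntegral_mono_on (outerLaplace_integrableOn hb hR)
    (outerLaplace_integrableOn hb hR) measurableSet_Ioi fun s hs => ?_
  have hs : 0 < s := hs
  apply Real.exp_le_exp.2
  nlinarith

lemma outerLaplace_nonneg {b R p : ℝ} : 0 ≤ outerLaplace b R p :=
  setIntegral_nonneg measurableSet_Ioi fun _ _ => (Real.exp_pos _).le

/-- Since `e^{R(1-e^{-bs})} ≥ 1`, the decrease is at least that of the pure exponential, `1/p -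
1/(p+1) > 0`. -/
lemma innerLaplace_strict {b R p : ℝ} (hb : 0 < b) (hR : 0 ≤ R) (hp : 0 < p) :
    innerLaplace b R (p + 1) < innerLaplace b R p := by
  have h1 : 1 / p - 1 / (p + 1) ≤ innerLaplace b R p - innerLaplace b R (p + 1) := by
    rw [← integral_exp_neg_mul hp, ← integral_exp_neg_mul (m := p + 1) (by linarith)]
    unfold innerLaplace
    rw [← integral_sub (integrableOn_exp_neg_mul hp) (integrableOn_exp_neg_mul (by linarith)),
      ← integral_sub (innerLaplace_integrableOn hR hp)
        (innerLaplace_integrableOn hR (by linarith))]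
    refine setIntegral_mono_on
      ((integrableOn_exp_neg_mul hp).sub (integrableOn_exp_neg_mul (by linarith)))
      ((innerLaplace_integrableOn hR hp).sub (innerLaplace_integrableOn hR (by linarith)))
      measurableSet_Ioi fun s hs => ?_
    have hs : 0 < s := hs
    have e1 : Real.exp (-((p + 1) * s)) = Real.exp (-(p * s)) * Real.exp (-s) := by
      rw [← Real.exp_add]; ring_nf
    have e2 : (1 : ℝ) ≤ Real.exp (R * (1 - Real.exp (-(b * s)))) := by
      apply Real.one_le_exp
      have : Real.exp (-(b * s)) ≤ 1 := Real.exp_le_one_iff.2 (by nlinarith)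
      nlinarith
    have e3 : Real.exp (-s) < 1 := Real.exp_lt_one_iff.2 (by linarith)
    rw [Real.exp_add, Real.exp_add, e1]
    have e4 : 0 ≤ Real.exp (-(p * s)) * (1 - Real.exp (-s)) :=
      mul_nonneg (Real.exp_pos _).le (by linarith)
    nlinarith
  have : 1 / (p + 1) < 1 / p := one_div_lt_one_div_of_lt hp (by linarith)
  linarith

/-! ### Convexity of the reciprocal inner moments. -/

/-- The superlevel set of a log-concave weight relative to an exponential is an interval;
hence their difference changes sign like a quadratic in `exp (-s)`. -/
lemma exists_quadratic_sign {b R p c lam : ℝ} (hR : 0 ≤ R) (hc : 0 < c) :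
    ∃ u₁ u₂ : ℝ, ∀ s : ℝ, 0 < s →
      (Real.exp (-(p * s) + R * (1 - Real.exp (-(b * s)))) - c * Real.exp (-(lam * s))) *
        ((Real.exp (-s) - u₁) * (Real.exp (-s) - u₂)) ≤ 0 := by
  set f : ℝ → ℝ := fun s => Real.exp (-(p * s) + R * (1 - Real.exp (-(b * s)))) with hf
  set g : ℝ → ℝ := fun s => c * Real.exp (-(lam * s)) with hg
  have hle : ∀ s, g s ≤ f s ↔
      Real.log c - lam * s ≤ -(p * s) + R * (1 - Real.exp (-(b * s))) := by
    intro s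
    have : g s = Real.exp (Real.log c - lam * s) := by
      simp only [hg]; rw [sub_eq_add_neg, Real.exp_add, Real.exp_log hc]
    rw [this]; exact Real.exp_le_exp
  -- `log f - log g` is concave because `-R e^{-bs}` is, so `{g ≤ f}` is an interval.
  have hconv : ∀ s₀ s s₂, s₀ < s → s < s₂ → g s₀ ≤ f s₀ → g s₂ ≤ f s₂ → g s ≤ f s := by
    intro s₀ s s₂ h0 h2 a0 a2
    rw [hle] at a0 a2 ⊢
    have hd : 0 < s₂ - s₀ := by linarith
    set τ := (s₂ - s) / (s₂ - s₀) with hτ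
    have t0 : 0 ≤ τ := div_nonneg (by linarith) hd.le
    have t1 : 0 ≤ 1 - τ := by
      rw [hτ, sub_nonneg, div_le_one hd]; linarith
    have hs : s = τ * s₀ + (1 - τ) * s₂ := by
      rw [hτ]; field_simp; ring
    have hexp := convexOn_exp.2 (Set.mem_univ (-(b * s₀))) (Set.mem_univ (-(b * s₂))) t0 t1
      (by ring)
    simp only [smul_eq_mul] at hexp
    have e : τ * -(b * s₀) + (1 - τ) * -(b * s₂) = -(b * s) := by rw [hs]; ring
    rw [e] at hexp
    have m1 := mul_le_mul_of_nonneg_left a0 t0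
    have m2 := mul_le_mul_of_nonneg_left a2 t1
    have m3 := mul_le_mul_of_nonneg_left hexp hR
    have e1 : lam * s = τ * (lam * s₀) + (1 - τ) * (lam * s₂) := by rw [hs]; ring
    have e2 : p * s = τ * (p * s₀) + (1 - τ) * (p * s₂) := by rw [hs]; ring
    rw [e1, e2]
    nlinarith
  set U : Set ℝ := {u | ∃ s, 0 < s ∧ u = Real.exp (-s) ∧ g s ≤ f s} with hU
  rcases U.eq_empty_or_nonempty with hE | hne
  · refine ⟨0, 0, fun s hs => ?_⟩
    have : ¬ g s ≤ f s := fun h => by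
      have : Real.exp (-s) ∈ U := ⟨s, hs, rfl, h⟩
      rw [hE] at this; exact this
    have h1 : f s - g s ≤ 0 := by linarith
    exact mul_nonpos_of_nonpos_of_nonneg h1 (by nlinarith [Real.exp_pos (-s)])
  have hba : BddAbove U := ⟨1, by rintro u ⟨s, hs, rfl, -⟩; exact Real.exp_le_one_iff.2 (by linarith)⟩
  have hbb : BddBelow U := ⟨0, by rintro u ⟨s, hs, rfl, -⟩; exact (Real.exp_pos _).le⟩
  -- In the variable `u = e^{-s}` the interval has these endpoints, so `(u-u₁)(u-u₂)` is nonpositive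
  -- on it and nonnegative off it.
  refine ⟨sSup U, sInf U, fun s hs => ?_⟩
  by_cases h : g s ≤ f s
  · have hm : Real.exp (-s) ∈ U := ⟨s, hs, rfl, h⟩
    have k1 := le_csSup hba hm
    have k2 := csInf_le hbb hm
    exact mul_nonpos_of_nonneg_of_nonpos (by linarith : 0 ≤ f s - g s)
      (mul_nonpos_of_nonpos_of_nonneg (by linarith) (by linarith))
  · have h1 : f s - g s ≤ 0 := by linarith
    refine mul_nonpos_of_nonpos_of_nonneg h1 ?_
    have hIS : sInf U ≤ sSup U := csInf_le_csSup hne hbb hba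
    rcases le_or_gt (sSup U) (Real.exp (-s)) with h2 | h2
    · exact mul_nonneg (by linarith) (by linarith)
    rcases le_or_gt (Real.exp (-s)) (sInf U) with h3 | h3
    · exact mul_nonneg_of_nonpos_of_nonpos (by linarith) (by linarith)
    exfalso
    obtain ⟨_, ⟨sa, ha, rfl, fa⟩, la⟩ := exists_lt_of_lt_csSup hne h2
    obtain ⟨_, ⟨sb, hsb, rfl, fb⟩, lb⟩ := exists_lt_of_csInf_lt hne h3
    rw [Real.exp_lt_exp] at la lb
    exact h (hconv sa s sb (by linarith) (by linarith) fa fb)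

lemma integral_sub_sub_add {X : Type*} [MeasurableSpace X] {μ : Measure X}
    {f₀ f₁ f₂ g₀ g₁ g₂ : X → ℝ} (h₂ : Integrable f₂ μ) (k₂ : Integrable g₂ μ)
    (h₁ : Integrable f₁ μ) (k₁ : Integrable g₁ μ) (h₀ : Integrable f₀ μ) (k₀ : Integrable g₀ μ)
    (a d : ℝ) :
    ∫ s, ((f₂ s - g₂ s) - a * (f₁ s - g₁ s) + d * (f₀ s - g₀ s)) ∂μ =
      (∫ s, f₂ s ∂μ - ∫ s, g₂ s ∂μ) - a * (∫ s, f₁ s ∂μ - ∫ s, g₁ s ∂μ)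
        + d * (∫ s, f₀ s ∂μ - ∫ s, g₀ s ∂μ) := by
  have e₂ : Integrable (fun s => f₂ s - g₂ s) μ := h₂.sub k₂
  have e₁ : Integrable (fun s => a * (f₁ s - g₁ s)) μ := (h₁.sub k₁).const_mul a
  have e₀ : Integrable (fun s => d * (f₀ s - g₀ s)) μ := (h₀.sub k₀).const_mul d
  rw [integral_add (f := fun s => (f₂ s - g₂ s) - a * (f₁ s - g₁ s)) (e₂.sub e₁) e₀,
    integral_sub e₂ e₁, integral_sub h₂ k₂, integral_const_mul, integral_const_mul,
    integral_sub h₁ k₁, integral_sub h₀ k₀]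

/-- The reciprocal of `innerLaplace` is convex along unit steps. -/
lemma inv_innerLaplace_convex {b R p : ℝ} (hb : 0 < b) (hR : 0 ≤ R) (hp : 0 < p) :
    2 / innerLaplace b R (p + 1) ≤ 1 / innerLaplace b R p + 1 / innerLaplace b R (p + 2) := by
  have hA := innerLaplace_pos hb hR hp
  have hB := innerLaplace_pos hb hR (p := p + 1) (by linarith)
  have hC := innerLaplace_pos hb hR (p := p + 2) (by linarith)
  have hAB := innerLaplace_strict hb hR hp
  set A := innerLaplace b R p with hAdef
  set B := innerLaplace b R (p + 1) with hBdef
  set C := innerLaplace b R (p + 2) with hCdef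
  -- `c e^{-λs}` is matched to the weight so that its moments against `1` and `e^{-s}`, namely `c/λ`
  -- and `c/(λ+1)`, equal `A` and `B`. For such an exponential the reciprocal moments are affine, so
  -- it is the equality case.
  set lam := B / (A - B) with hlam
  have hl : 0 < lam := div_pos hB (by linarith)
  set c := A * lam with hcdef
  have hc : 0 < c := mul_pos hA hl
  obtain ⟨u₁, u₂, hu⟩ := exists_quadratic_sign (b := b) (R := R) (p := p) (c := c) (lam := lam) hR hc
  have i0 := innerLaplace_integrableOn (b := b) hR hp
  have i1 := innerLaplace_integrableOn (b := b) (p := p + 1) hR (by linarith)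
  have i2 := innerLaplace_integrableOn (b := b) (p := p + 2) hR (by linarith)
  have j0 := (integrableOn_exp_neg_mul hl).const_mul c
  have j1 := (integrableOn_exp_neg_mul (m := lam + 1) (by linarith)).const_mul c
  have j2 := (integrableOn_exp_neg_mul (m := lam + 2) (by linarith)).const_mul c
  have key : ∫ s in Set.Ioi (0 : ℝ),
      ((Real.exp (-((p + 2) * s) + R * (1 - Real.exp (-(b * s))))
          - c * Real.exp (-((lam + 2) * s)))
        - (u₁ + u₂) * (Real.exp (-((p + 1) * s) + R * (1 - Real.exp (-(b * s))))
          - c * Real.exp (-((lam + 1) * s)))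
        + u₁ * u₂ * (Real.exp (-(p * s) + R * (1 - Real.exp (-(b * s))))
          - c * Real.exp (-(lam * s)))) ≤ 0 := by
    refine setIntegral_nonpos measurableSet_Ioi fun s hs => ?_
    have h := hu s hs
    have e1 : Real.exp (-((p + 1) * s) + R * (1 - Real.exp (-(b * s)))) =
      Real.exp (-(p * s) + R * (1 - Real.exp (-(b * s)))) * Real.exp (-s) := by
      rw [← Real.exp_add]; ring_nf
    have e2 : Real.exp (-((p + 2) * s) + R * (1 - Real.exp (-(b * s)))) =
      Real.exp (-(p * s) + R * (1 - Real.exp (-(b * s)))) * Real.exp (-s) ^ 2 := by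
      rw [← Real.exp_nat_mul, ← Real.exp_add]; push_cast; ring_nf
    have e3 : Real.exp (-((lam + 1) * s)) = Real.exp (-(lam * s)) * Real.exp (-s) := by
      rw [← Real.exp_add]; ring_nf
    have e4 : Real.exp (-((lam + 2) * s)) = Real.exp (-(lam * s)) * Real.exp (-s) ^ 2 := by
      rw [← Real.exp_nat_mul, ← Real.exp_add]; push_cast; ring_nf
    rw [e1, e2, e3, e4]
    linarith
  have key := (integral_sub_sub_add i2 j2 i1 j1 i0 j0 (u₁ + u₂) (u₁ * u₂)).ge.trans key
  rw [integral_const_mul, integral_const_mul, integral_const_mul, integral_exp_neg_mul hl,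
    integral_exp_neg_mul (m := lam + 1) (by linarith),
    integral_exp_neg_mul (m := lam + 2) (by linarith)] at key
  change (C - _) - _ * (B - _) + _ * (A - _) ≤ 0 at key
  have hAB' : A - B ≠ 0 := by linarith
  have z0 : A - c * (1 / lam) = 0 := by rw [hcdef]; field_simp; ring
  have z1 : B - c * (1 / (lam + 1)) = 0 := by
    have : lam + 1 = A / (A - B) := by rw [hlam]; field_simp; ring
    rw [this, hcdef, hlam]; field_simp; ring
  -- With the two lower moments matched, the roots `u₁`, `u₂` drop out and only a comparison of the
  -- third moments is left.
  rw [z0, z1] at key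
  have hC' : C ≤ c / (lam + 2) := by
    have : c * (1 / (lam + 2)) = c / (lam + 2) := by ring
    linarith
  have h3 : (lam + 2) / c = 2 / B - 1 / A := by
    have : lam + 2 = (2 * A - B) / (A - B) := by rw [hlam]; field_simp; ring
    rw [this, hcdef, hlam]; field_simp
  have h4 : (lam + 2) / c ≤ 1 / C := by
    rw [le_div_iff₀ hC, div_mul_eq_mul_div, div_le_one hc]
    rw [le_div_iff₀ (by linarith)] at hC'
    linarith
  linarith

/-! ### Norms and kernel in terms of the Laplace integrals. -/

lemma boltzmann_of_wall {b α r₁ r₂ s : ℝ} {n : ℕ} {z : ℂ} (hs : 0 < s)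
    (h : r₁ < ‖z‖ ∧ ‖z‖ < r₂) : boltzmann b α r₁ r₂ n s z = 0 := by
  simp [boltzmann, potential, h, EReal.coe_mul_top_of_pos hs]

lemma boltzmann_of_not_wall {b α r₁ r₂ s : ℝ} {n : ℕ} {z : ℂ}
    (h : ¬ (r₁ < ‖z‖ ∧ ‖z‖ < r₂)) : boltzmann b α r₁ r₂ n s z =
      Real.exp (-(s * (‖z‖ ^ (2 * b) - 2 * α / n * Real.log ‖z‖))) := by
  rw [boltzmann, potential, if_neg h, ← EReal.coe_mul, ← EReal.coe_neg, EReal.exp_coe]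
  exact ENNReal.toReal_ofReal (Real.exp_pos _).le

lemma integral_comp_norm (f : ℝ → ℝ) :
    ∫ z : ℂ, f ‖z‖ = 2 * Real.pi * ∫ v in Set.Ioi (0 : ℝ), v * f v := by
  have h := integral_fun_norm_addHaar (volume : Measure ℂ) f
  rw [h, Complex.finrank_real_complex]
  simp [Measure.real]
  ring

lemma image_inner {r : ℝ} (hr : 0 < r) :
    (fun s : ℝ => r * Real.exp (-(s / 2))) '' Set.Ioi 0 = Set.Ioo 0 r := by
  ext v
  constructor
  · rintro ⟨s, hs, rfl⟩
    have hs : 0 < s := hs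
    have : Real.exp (-(s / 2)) < 1 := Real.exp_lt_one_iff.2 (by linarith)
    exact ⟨by positivity, by nlinarith⟩
  · rintro ⟨h0, h1⟩
    refine ⟨-2 * Real.log (v / r), ?_, ?_⟩
    · have : Real.log (v / r) < 0 := Real.log_neg (by positivity) ((div_lt_one hr).2 h1)
      simp only [Set.mem_Ioi]; linarith
    · have : -(-2 * Real.log (v / r) / 2) = Real.log (v / r) := by ring
      simp only [this]
      rw [Real.exp_log (by positivity)]; field_simp

lemma image_outer {r : ℝ} (hr : 0 < r) :
    (fun s : ℝ => r * Real.exp (s / 2)) '' Set.Ioi 0 = Set.Ioi r := by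
  ext v
  constructor
  · rintro ⟨s, hs, rfl⟩
    have hs : 0 < s := hs
    have : 1 < Real.exp (s / 2) := Real.one_lt_exp_iff.2 (by linarith)
    simp only [Set.mem_Ioi]; nlinarith
  · intro h1
    have h1 : r < v := h1
    refine ⟨2 * Real.log (v / r), ?_, ?_⟩
    · have : 0 < Real.log (v / r) := Real.log_pos ((one_lt_div hr).2 h1)
      simp only [Set.mem_Ioi]; linarith
    · have h0 : 0 < v := hr.trans h1
      have : 2 * Real.log (v / r) / 2 = Real.log (v / r) := by ring
      simp only [this]
      rw [Real.exp_log (by positivity)]; field_simp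

lemma mul_exp_rpow {r y a : ℝ} (hr : 0 < r) :
    (r * Real.exp y) ^ a = r ^ a * Real.exp (a * y) := by
  rw [Real.mul_rpow hr.le (Real.exp_pos _).le, ← Real.exp_mul, mul_comm y]

/-- Substitution `v = r e^{-s/2}`; the leading `2` cancels the Jacobian's `1/2`, and `dv/v` lowers
the exponent by one. -/
lemma integral_inner {b r p N : ℝ} (hr : 0 < r) :
    2 * ∫ v in Set.Ioo 0 r, v ^ (2 * p - 1) * Real.exp (-(N * v ^ (2 * b))) =
      r ^ (2 * p) * Real.exp (-(N * r ^ (2 * b))) * innerLaplace b (N * r ^ (2 * b)) p := by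
  rw [← image_inner hr, integral_image_eq_integral_abs_deriv_smul
    (f' := fun s => r * (Real.exp (-(s / 2)) * (-(1 / 2)))) measurableSet_Ioi
    (fun s _ => ?_) (fun s _ t _ h => ?_), innerLaplace, ← integral_const_mul, ← integral_const_mul]
  · congr 1; ext s
    have h0 : 0 < r * Real.exp (-(s / 2)) := by positivity
    have e1 : |r * (Real.exp (-(s / 2)) * (-(1 / 2)))| = r * Real.exp (-(s / 2)) / 2 := by
      rw [show r * (Real.exp (-(s / 2)) * (-(1 / 2))) = -(r * Real.exp (-(s / 2)) / 2) by ring,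
        abs_neg, abs_of_pos (by positivity)]
    rw [e1, smul_eq_mul, Real.rpow_sub_one h0.ne', mul_exp_rpow hr, mul_exp_rpow hr]
    rw [show 2 * b * -(s / 2) = -(b * s) by ring, show 2 * p * -(s / 2) = -(p * s) by ring]
    have : 2 * (r * Real.exp (-(s / 2)) / 2 *
        (r ^ (2 * p) * Real.exp (-(p * s)) / (r * Real.exp (-(s / 2))) *
          Real.exp (-(N * (r ^ (2 * b) * Real.exp (-(b * s))))))) =
        r ^ (2 * p) * (Real.exp (-(p * s)) *
          Real.exp (-(N * (r ^ (2 * b) * Real.exp (-(b * s)))))) := by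
      field_simp
    rw [this, mul_assoc, ← Real.exp_add, ← Real.exp_add]
    ring_nf
  · have := ((hasDerivAt_id s).div_const 2).neg.exp.const_mul r
    exact this.hasDerivWithinAt
  · have h : r * Real.exp (-(s / 2)) = r * Real.exp (-(t / 2)) := h
    have := Real.exp_injective (mul_left_cancel₀ hr.ne' h)
    linarith

lemma integral_outer {b r p N : ℝ} (hr : 0 < r) :
    2 * ∫ v in Set.Ioi r, v ^ (2 * p - 1) * Real.exp (-(N * v ^ (2 * b))) =
      r ^ (2 * p) * Real.exp (-(N * r ^ (2 * b))) * outerLaplace b (N * r ^ (2 * b)) p := by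
  rw [← image_outer hr, integral_image_eq_integral_abs_deriv_smul
    (f' := fun s => r * (Real.exp (s / 2) * (1 / 2))) measurableSet_Ioi
    (fun s _ => ?_) (fun s _ t _ h => ?_), outerLaplace, ← integral_const_mul, ← integral_const_mul]
  · congr 1; ext s
    have h0 : 0 < r * Real.exp (s / 2) := by positivity
    rw [abs_of_pos (by positivity), smul_eq_mul, Real.rpow_sub_one h0.ne', mul_exp_rpow hr,
      mul_exp_rpow hr]
    rw [show 2 * b * (s / 2) = b * s by ring, show 2 * p * (s / 2) = p * s by ring]
    have : 2 * (r * (Real.exp (s / 2) * (1 / 2)) *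
        (r ^ (2 * p) * Real.exp (p * s) / (r * Real.exp (s / 2)) *
          Real.exp (-(N * (r ^ (2 * b) * Real.exp (b * s)))))) =
        r ^ (2 * p) * (Real.exp (p * s) *
          Real.exp (-(N * (r ^ (2 * b) * Real.exp (b * s))))) := by
      field_simp
    rw [this, mul_assoc, ← Real.exp_add, ← Real.exp_add]
    ring_nf
  · have := ((hasDerivAt_id s).div_const 2).exp.const_mul r
    exact this.hasDerivWithinAt
  · have h : r * Real.exp (s / 2) = r * Real.exp (t / 2) := h
    have := Real.exp_injective (mul_left_cancel₀ hr.ne' h)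
    linarith

lemma exp_boltzmann {v b α n s : ℝ} (hv : 0 < v) (hn : n ≠ 0) :
    Real.exp (-(n * s * (v ^ (2 * b) - 2 * α / n * Real.log v))) =
      v ^ (2 * α * s) * Real.exp (-(n * s * v ^ (2 * b))) := by
  rw [Real.rpow_def_of_pos hv (2 * α * s), ← Real.exp_add]
  congr 1; field_simp; ring

lemma normSq_eq_integrals {b α r₁ r₂ : ℝ} (hb : 0 < b) (hα : -1 < α)
    (hr₁ : 0 < r₁) (hr₁₂ : r₁ < r₂) {n j : ℕ} (hn : 1 ≤ n) (hj : 1 ≤ j) :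
    normSq b α r₁ r₂ n j =
      2 * (∫ v in Set.Ioo 0 r₁, v ^ (2 * ((j : ℝ) + α) - 1) * Real.exp (-(n * v ^ (2 * b))))
      + 2 * ∫ v in Set.Ioi r₂, v ^ (2 * ((j : ℝ) + α) - 1) * Real.exp (-(n * v ^ (2 * b))) := by
  classical
  have hn0 : (0 : ℝ) < n := by exact_mod_cast hn
  have hj1 : (1 : ℝ) ≤ j := by exact_mod_cast hj
  set F : ℝ → ℝ := fun v => v ^ (2 * ((j : ℝ) + α) - 1) * Real.exp (-(n * v ^ (2 * b))) with hF
  have hFi : IntegrableOn F (Set.Ioi 0) := by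
    have := integrableOn_rpow_mul_exp_neg_mul_rpow (p := 2 * b) (s := 2 * ((j : ℝ) + α) - 1)
      (b := n) (by linarith) (by linarith) hn0
    simpa [hF, neg_mul] using this
  have h1 : ∀ z : ℂ, ‖z‖ ^ (2 * (j - 1)) * boltzmann b α r₁ r₂ n n z =
      (fun v : ℝ => v ^ (2 * (j - 1)) * (if r₁ < v ∧ v < r₂ then 0 else
        Real.exp (-(n * (v ^ (2 * b) - 2 * α / n * Real.log v))))) ‖z‖ := by
    intro z
    by_cases h : r₁ < ‖z‖ ∧ ‖z‖ < r₂
    · simp only [boltzmann_of_wall hn0 h, if_pos h]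
    · simp only [boltzmann_of_not_wall h, if_neg h]
  have h2 := integral_comp_norm (fun v : ℝ => v ^ (2 * (j - 1)) * (if r₁ < v ∧ v < r₂ then 0 else
        Real.exp (-(n * (v ^ (2 * b) - 2 * α / n * Real.log v)))))
  rw [normSq, integral_congr_ae (Eventually.of_forall h1), h2]
  have hpi := Real.pi_pos.ne'
  have hset : ∫ v in Set.Ioi (0 : ℝ), v * (v ^ (2 * (j - 1)) * (if r₁ < v ∧ v < r₂ then 0 else
        Real.exp (-(n * (v ^ (2 * b) - 2 * α / n * Real.log v))))) =
      ∫ v in Set.Ioi (0 : ℝ), (Set.Ioo r₁ r₂)ᶜ.indicator F v := by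
    refine setIntegral_congr_fun measurableSet_Ioi fun v hv => ?_
    have hv : 0 < v := hv
    by_cases h : r₁ < v ∧ v < r₂
    · simp [Set.indicator_of_notMem, h]
    · have hm : v ∈ (Set.Ioo r₁ r₂)ᶜ := h
      simp only [if_neg h, Set.indicator_of_mem hm, hF]
      have := exp_boltzmann (v := v) (b := b) (α := α) (n := n) (s := 1) hv hn0.ne'
      simp only [mul_one] at this
      rw [this, ← mul_assoc, ← mul_assoc]
      congr 1
      rw [← Real.rpow_natCast, ← Real.rpow_one_add' hv.le, ← Real.rpow_add hv]
      · congr 1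
        push_cast [Nat.cast_sub hj]; ring
      · push_cast [Nat.cast_sub hj]; nlinarith
  rw [hset, setIntegral_indicator measurableSet_Ioo.compl]
  have hU : Set.Ioi (0 : ℝ) ∩ (Set.Ioo r₁ r₂)ᶜ = Set.Ioc 0 r₁ ∪ Set.Ici r₂ := by
    ext v
    simp only [Set.mem_inter_iff, Set.mem_Ioi, Set.mem_compl_iff, Set.mem_Ioo, not_and, not_lt,
      Set.mem_union, Set.mem_Ioc, Set.mem_Ici]
    constructor
    · rintro ⟨h0, h⟩
      rcases le_or_gt v r₁ with h1 | h1
      · exact Or.inl ⟨h0, h1⟩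
      · exact Or.inr (h h1)
    · rintro (⟨h0, h⟩ | h)
      · exact ⟨h0, fun h' => absurd h' (not_lt.2 h)⟩
      · exact ⟨by linarith, fun _ => h⟩
  rw [hU, setIntegral_union _ measurableSet_Ici
    (hFi.mono_set fun v hv => hv.1) (hFi.mono_set fun v hv => ?_), integral_Ioc_eq_integral_Ioo,
    integral_Ici_eq_integral_Ioi]
  · field_simp
  · rw [Set.disjoint_left]
    intro v hv hv'
    have : r₂ ≤ v := hv'
    linarith [hv.2]
  · have : r₂ ≤ v := hv
    exact (by linarith : 0 < v)

/-- The definition of `σ⋆` makes `j⋆` the index at which the boundary values `r^{2(j+α)} e^{-n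
r^{2b}}` at `r₁` and `r₂` agree. Their ratio is therefore exactly `(r₂/r₁)^{2(j-j⋆)}`. -/
lemma normSq_eq {b α r₁ r₂ : ℝ} (hb : 0 < b) (hα : -1 < α)
    (hr₁ : 0 < r₁) (hr₁₂ : r₁ < r₂) {n j : ℕ} (hn : 1 ≤ n) (hj : 1 ≤ j) :
    normSq b α r₁ r₂ n j =
      r₁ ^ (2 * ((j : ℝ) + α)) * Real.exp (-(n * r₁ ^ (2 * b))) *
      (innerLaplace b (n * r₁ ^ (2 * b)) (j + α) +
        (r₂ / r₁) ^ (2 * ((j : ℝ) - jStar b α r₁ r₂ n)) *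
          outerLaplace b (n * r₂ ^ (2 * b)) (j + α)) := by
  have hr₂ : 0 < r₂ := hr₁.trans hr₁₂
  rw [normSq_eq_integrals hb hα hr₁ hr₁₂ hn hj, integral_inner hr₁, integral_outer hr₂]
  have hl : 0 < Real.log (r₂ / r₁) := Real.log_pos ((one_lt_div hr₁).2 hr₁₂)
  have key : (r₂ / r₁) ^ (2 * ((j : ℝ) - jStar b α r₁ r₂ n)) =
      r₂ ^ (2 * ((j : ℝ) + α)) * Real.exp (-(n * r₂ ^ (2 * b))) /
        (r₁ ^ (2 * ((j : ℝ) + α)) * Real.exp (-(n * r₁ ^ (2 * b)))) := by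
    have e1 : 2 * ((j : ℝ) - jStar b α r₁ r₂ n) = 2 * (j + α) - 2 * (n * sigmaStar b r₁ r₂) := by
      rw [jStar]; ring
    have e2 : (r₂ / r₁) ^ (2 * (n * sigmaStar b r₁ r₂)) =
        Real.exp (n * r₂ ^ (2 * b) - n * r₁ ^ (2 * b)) := by
      rw [Real.rpow_def_of_pos (by positivity), sigmaStar]
      congr 1; field_simp
    rw [e1, Real.rpow_sub (by positivity), e2, Real.div_rpow hr₂.le hr₁.le, sub_eq_add_neg,
      Real.exp_add, Real.exp_neg, Real.exp_neg]
    field_simp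
  rw [key]
  field_simp

/-- The radial profile of the kernel at relative depth `τ` inside the inner disc. -/
noncomputable def radialFactor (b α r₁ : ℝ) (n : ℕ) (τ : ℝ) : ℝ :=
  (1 - τ) ^ α * Real.exp (n * r₁ ^ (2 * b) / 2 * (1 - (1 - τ) ^ (2 * b)))

lemma boltzmann_half {b α r₁ r₂ : ℝ} (hr₁ : 0 < r₁) {n : ℕ} (hn : 1 ≤ n) {τ θ : ℝ} (hτ : 0 ≤ τ)
    (hτ1 : τ < 1) :
    boltzmann b α r₁ r₂ n (n / 2) ((r₁ * (1 - τ) : ℝ) * Complex.exp (Complex.I * θ)) =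
      r₁ ^ α * Real.exp (-(n / 2 * r₁ ^ (2 * b))) * radialFactor b α r₁ n τ := by
  have hn0 : (0 : ℝ) < n := by exact_mod_cast hn
  have hv : 0 < r₁ * (1 - τ) := mul_pos hr₁ (by linarith)
  have hnorm : ‖((r₁ * (1 - τ) : ℝ) : ℂ) * Complex.exp (Complex.I * θ)‖ = r₁ * (1 - τ) := by
    rw [norm_mul, mul_comm Complex.I, Complex.norm_exp_ofReal_mul_I, Complex.norm_real, mul_one,
      Real.norm_of_nonneg hv.le]
  rw [boltzmann_of_not_wall, hnorm]
  · have h := exp_boltzmann (v := r₁ * (1 - τ)) (b := b) (α := α) (n := n) (s := 1 / 2) hv hn0.ne'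
    rw [show (n : ℝ) / 2 = n * (1 / 2) by ring, h, radialFactor,
      Real.mul_rpow hr₁.le (by linarith), Real.mul_rpow hr₁.le (by linarith)]
    rw [show 2 * α * (1 / 2) = α by ring]
    rw [mul_mul_mul_comm (r₁ ^ α), ← Real.exp_add]
    congr 2; ring
  · rw [hnorm]
    intro h
    nlinarith [h.1]

/-- The prefactor of `h_j` cancels against the Boltzmann factors and `(r₁²)^{j-1}`; the shift `j-1`
versus `j` leaves `r₁^{-2}`. -/
lemma kernel_eq {b α r₁ r₂ : ℝ} (hb : 0 < b) (hα : -1 < α)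
    (hr₁ : 0 < r₁) (hr₁₂ : r₁ < r₂) {n : ℕ} (hn : 1 ≤ n) {τ₁ τ₂ θ₁ θ₂ : ℝ}
    (h₁ : 0 ≤ τ₁) (h₁' : τ₁ < 1) (h₂ : 0 ≤ τ₂) (h₂' : τ₂ < 1) :
    kernel b α r₁ r₂ n ((r₁ * (1 - τ₁) : ℝ) * Complex.exp (Complex.I * θ₁))
        ((r₁ * (1 - τ₂) : ℝ) * Complex.exp (Complex.I * θ₂)) =
      ((r₁ ^ (-2 : ℝ) * (radialFactor b α r₁ n τ₁ * radialFactor b α r₁ n τ₂) : ℝ) : ℂ) *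
        ∑ j ∈ Finset.Icc 1 n,
          (((1 - τ₁) * (1 - τ₂) : ℝ) * Complex.exp (Complex.I * (θ₁ - θ₂))) ^ (j - 1) /
            ((innerLaplace b (n * r₁ ^ (2 * b)) (j + α) +
              (r₂ / r₁) ^ (2 * ((j : ℝ) - jStar b α r₁ r₂ n)) *
                outerLaplace b (n * r₂ ^ (2 * b)) (j + α) : ℝ) : ℂ) := by
  rw [kernel, boltzmann_half hr₁ hn h₁ h₁', boltzmann_half hr₁ hn h₂ h₂', Finset.mul_sum,
    Finset.mul_sum]
  refine Finset.sum_congr rfl fun j hj => ?_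
  have hj1 : 1 ≤ j := (Finset.mem_Icc.1 hj).1
  rw [normSq_eq hb hα hr₁ hr₁₂ hn hj1]
  set M : ℝ := innerLaplace b (n * r₁ ^ (2 * b)) (j + α) +
              (r₂ / r₁) ^ (2 * ((j : ℝ) - jStar b α r₁ r₂ n)) *
                outerLaplace b (n * r₂ ^ (2 * b)) (j + α) with hM
  have hzw : ((r₁ * (1 - τ₁) : ℝ) * Complex.exp (Complex.I * θ₁)) *
      (starRingEnd ℂ) (((r₁ * (1 - τ₂) : ℝ) : ℂ) * Complex.exp (Complex.I * θ₂)) =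
      ((r₁ ^ 2 : ℝ) : ℂ) *
        (((1 - τ₁) * (1 - τ₂) : ℝ) * Complex.exp (Complex.I * (θ₁ - θ₂))) := by
    rw [map_mul, Complex.conj_ofReal, ← Complex.exp_conj, map_mul, Complex.conj_I,
      Complex.conj_ofReal,
      show Complex.I * ((θ₁ : ℂ) - θ₂) = Complex.I * θ₁ + -Complex.I * θ₂ by ring,
      Complex.exp_add]
    push_cast
    ring_nf
  rw [← mul_pow, hzw, mul_pow]
  set W := (((1 - τ₁) * (1 - τ₂) : ℝ) * Complex.exp (Complex.I * (θ₁ - θ₂)) : ℂ) ^ (j - 1) with hW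
  have hscal : r₁ ^ α * Real.exp (-(n / 2 * r₁ ^ (2 * b))) *
      (r₁ ^ α * Real.exp (-(n / 2 * r₁ ^ (2 * b)))) * (r₁ ^ 2) ^ (j - 1) =
      r₁ ^ (-2 : ℝ) * (r₁ ^ (2 * ((j : ℝ) + α)) * Real.exp (-(n * r₁ ^ (2 * b)))) := by
    rw [mul_mul_mul_comm, ← Real.exp_add, ← Real.rpow_natCast, ← Real.rpow_natCast,
      ← Real.rpow_mul hr₁.le, ← Real.rpow_add hr₁, mul_right_comm, ← Real.rpow_add hr₁, ← mul_assoc,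
      ← Real.rpow_add hr₁]
    congr 2
    · push_cast [Nat.cast_sub hj1]; ring
    · ring
  set E₁ := radialFactor b α r₁ n τ₁
  set E₂ := radialFactor b α r₁ n τ₂
  have hP : r₁ ^ (2 * ((j : ℝ) + α)) * Real.exp (-(n * r₁ ^ (2 * b))) ≠ 0 := by positivity
  set P := r₁ ^ (2 * ((j : ℝ) + α)) * Real.exp (-(n * r₁ ^ (2 * b))) with hPdef
  set S := r₁ ^ α * Real.exp (-(n / 2 * r₁ ^ (2 * b))) with hS
  have hPc : (P : ℂ) ≠ 0 := by exact_mod_cast hP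
  have hscalc : (S : ℂ) * S * ((r₁ ^ 2 : ℝ) : ℂ) ^ (j - 1) = (r₁ ^ (-2 : ℝ) : ℝ) * P := by
    exact_mod_cast hscal
  calc ((S * E₁ : ℝ) : ℂ) * ((S * E₂ : ℝ) : ℂ) * (((r₁ ^ 2 : ℝ) : ℂ) ^ (j - 1) * W / ((P * M : ℝ) : ℂ))
      = ((S : ℂ) * S * ((r₁ ^ 2 : ℝ) : ℂ) ^ (j - 1)) * (E₁ * E₂ * W / (P * M)) := by
        push_cast; ring
    _ = ((r₁ ^ (-2 : ℝ) * (E₁ * E₂) : ℝ) : ℂ) * (W / (M : ℂ)) := by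
        rw [hscalc]; push_cast; field_simp

/-! ### The bilateral series and its limit on the inner circle. -/

/-- The half `l ≥ 0` of the regularised bilateral series. -/
noncomputable def positiveTail (c κ : ℝ) (ζ : ℂ) : ℂ :=
  ∑' l : ℕ, ζ ^ l / ((1 + c * κ ^ l : ℝ) : ℂ)

/-- The half `l < 0` of the regularised bilateral series, after the geometric part is removed. -/
noncomputable def negativeTail (c κ : ℝ) (ζ : ℂ) : ℂ :=
  ∑' k : ℕ, ζ⁻¹ ^ (k + 1) / ((1 + c⁻¹ * κ ^ (k + 1) : ℝ) : ℂ)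

lemma norm_div_one_add {a : ℝ} (ha : 0 < a) (z : ℂ) :
    ‖z / ((1 + a : ℝ) : ℂ)‖ ≤ ‖z‖ / a := by
  rw [norm_div, Complex.norm_real, Real.norm_of_nonneg (by positivity)]
  gcongr; linarith

lemma norm_positiveTail_term {c κ : ℝ} (hc : 0 < c) (hκ : 1 < κ) (z : ℂ) (l : ℕ) :
    ‖z ^ l / ((1 + c * κ ^ l : ℝ) : ℂ)‖ ≤ c⁻¹ * (‖z‖ / κ) ^ l := by
  refine (norm_div_one_add (by positivity) _).trans_eq ?_
  rw [norm_pow, div_pow]; field_simp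

lemma norm_negativeTail_term {c κ : ℝ} (hc : 0 < c) (hκ : 1 < κ) {z : ℂ} (hz : 1 ≤ ‖z‖) (k : ℕ) :
    ‖z⁻¹ ^ (k + 1) / ((1 + c⁻¹ * κ ^ (k + 1) : ℝ) : ℂ)‖ ≤ c * κ⁻¹ ^ (k + 1) := by
  refine (norm_div_one_add (by positivity) _).trans ?_
  have : ‖z⁻¹ ^ (k + 1)‖ ≤ 1 := by
    rw [norm_pow, norm_inv]
    exact pow_le_one₀ (by positivity) (inv_le_one_of_one_le₀ hz)
  calc _ ≤ 1 / (c⁻¹ * κ ^ (k + 1)) := by gcongr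
    _ = _ := by rw [inv_pow]; field_simp

lemma summable_const_mul_geometric {C ρ : ℝ} (h0 : 0 ≤ ρ) (h1 : ρ < 1) :
    Summable fun l : ℕ => C * ρ ^ l :=
  (summable_geometric_of_lt_one h0 h1).mul_left C

lemma summable_const_mul_geometric_succ {C ρ : ℝ} (h0 : 0 ≤ ρ) (h1 : ρ < 1) :
    Summable fun l : ℕ => C * ρ ^ (l + 1) :=
  (summable_nat_add_iff 1).2 (summable_const_mul_geometric (C := C) h0 h1)

/-- For negative indices `1/(1+a) = 1 - 1/(1+a⁻¹)`. The ones form the geometric series `1/(z-1)`,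
and what remains also converges on `‖z‖ = 1`. -/
lemma bilateral_tsum {c κ : ℝ} (hc : 0 < c) (hκ : 1 < κ) {z : ℂ} (hz : 1 < ‖z‖)
    (hz' : ‖z‖ < κ) :
    ∑' l : ℤ, z ^ l / ((1 + c * κ ^ l : ℝ) : ℂ) =
      1 / (z - 1) + positiveTail c κ z - negativeTail c κ z := by
  have hκ0 : 0 < κ := by linarith
  have hz0 : z ≠ 0 := by
    intro h; rw [h, norm_zero] at hz; linarith
  have hz1 : z - 1 ≠ 0 := by
    intro h; rw [sub_eq_zero.1 h, norm_one] at hz; exact lt_irrefl _ hz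
  have hp : HasSum (fun l : ℕ => z ^ l / ((1 + c * κ ^ l : ℝ) : ℂ)) (positiveTail c κ z) := by
    refine (Summable.of_norm_bounded (summable_const_mul_geometric (C := c⁻¹) (ρ := ‖z‖ / κ)
      (by positivity) ((div_lt_one hκ0).2 hz')) fun l => norm_positiveTail_term hc hκ z l).hasSum
  have hm : HasSum (fun k : ℕ => z⁻¹ ^ (k + 1) / ((1 + c⁻¹ * κ ^ (k + 1) : ℝ) : ℂ))
      (negativeTail c κ z) := by
    refine (Summable.of_norm_bounded (summable_const_mul_geometric_succ (C := c) (ρ := κ⁻¹)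
      (by positivity) (inv_lt_one_of_one_lt₀ hκ)) fun l =>
        norm_negativeTail_term hc hκ hz.le l).hasSum
  have hg : HasSum (fun k : ℕ => z⁻¹ ^ (k + 1)) (1 / (z - 1)) := by
    have := (hasSum_geometric_of_norm_lt_one (ξ := z⁻¹)
      (by rw [norm_inv]; exact inv_lt_one_of_one_lt₀ hz)).mul_left z⁻¹
    have e : z⁻¹ * (1 - z⁻¹)⁻¹ = 1 / (z - 1) := by
      rw [← mul_inv, mul_sub, mul_one, mul_inv_cancel₀ hz0, one_div]
    rw [e] at this
    simpa only [pow_succ'] using this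
  have hneg : HasSum (fun k : ℕ => z ^ (-((k : ℤ) + 1)) / ((1 + c * κ ^ (-((k : ℤ) + 1)) : ℝ) : ℂ))
      (1 / (z - 1) - negativeTail c κ z) := by
    suffices hfun : ∀ k : ℕ, z ^ (-((k : ℤ) + 1)) / ((1 + c * κ ^ (-((k : ℤ) + 1)) : ℝ) : ℂ) =
        z⁻¹ ^ (k + 1) - z⁻¹ ^ (k + 1) / ((1 + c⁻¹ * κ ^ (k + 1) : ℝ) : ℂ) by
      simp only [hfun]; exact hg.sub hm
    intro k
    have e1 : z ^ (-((k : ℤ) + 1)) = z⁻¹ ^ (k + 1) := by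
      rw [zpow_neg, inv_pow]; norm_cast
    have e2 : κ ^ (-((k : ℤ) + 1)) = (κ ^ (k + 1))⁻¹ := by
      rw [zpow_neg]; norm_cast
    rw [e1, e2]
    set K := κ ^ (k + 1) with hK
    have hKpos : 0 < K := by positivity
    have e3 : (1 + c * K⁻¹) * (1 - 1 / (1 + c⁻¹ * K)) = 1 := by
      have : 1 + c⁻¹ * K ≠ 0 := by positivity
      field_simp; ring
    have e4 : (1 : ℝ) / (1 + c * K⁻¹) = 1 - 1 / (1 + c⁻¹ * K) := by
      have : 1 + c * K⁻¹ ≠ 0 := by positivity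
      rw [div_eq_iff this, mul_comm]; exact e3.symm
    have e5 : (1 : ℂ) / ((1 + c * K⁻¹ : ℝ) : ℂ) = 1 - 1 / ((1 + c⁻¹ * K : ℝ) : ℂ) := by
      exact_mod_cast congrArg (fun t : ℝ => (t : ℂ)) e4
    calc z⁻¹ ^ (k + 1) / ((1 + c * K⁻¹ : ℝ) : ℂ)
        = z⁻¹ ^ (k + 1) * (1 / ((1 + c * K⁻¹ : ℝ) : ℂ)) := by ring
      _ = _ := by rw [e5]; ring
  have hp' : HasSum (fun l : ℕ => z ^ (l : ℤ) / ((1 + c * κ ^ (l : ℤ) : ℝ) : ℂ))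
      (positiveTail c κ z) := by simpa only [zpow_natCast] using hp
  have h := HasSum.of_nat_of_neg_add_one
    (f := fun l : ℤ => z ^ l / ((1 + c * κ ^ l : ℝ) : ℂ)) hp' hneg
  rw [h.tsum_eq]; ring

lemma bilateral_abel {c κ : ℝ} (hc : 0 < c) (hκ : 1 < κ) {ζ : ℂ} (hζ : ‖ζ‖ = 1) (hζ1 : ζ ≠ 1) :
    Tendsto (fun y : ℝ => ∑' l : ℤ, (y * ζ) ^ l / ((1 + c * κ ^ l : ℝ) : ℂ)) (𝓝[>] 1)
      (𝓝 (1 / (ζ - 1) + positiveTail c κ ζ - negativeTail c κ ζ)) := by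
  have hκ0 : 0 < κ := by linarith
  have hζ0 : ζ ≠ 0 := by rw [← norm_pos_iff, hζ]; exact one_pos
  have hcont : Tendsto (fun y : ℝ => (y : ℂ) * ζ) (𝓝[>] 1) (𝓝 ζ) := by
    have : Continuous fun y : ℝ => (y : ℂ) * ζ := by fun_prop
    have h := this.tendsto 1
    rw [Complex.ofReal_one, one_mul] at h
    exact h.mono_left nhdsWithin_le_nhds
  -- Staying below the midpoint of `(1, κ)` provides a geometric majorant for the positive half that
  -- does not depend on `y`.
  have hev : ∀ᶠ y : ℝ in 𝓝[>] 1, 1 < y ∧ y < (1 + κ) / 2 :=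
    Ioo_mem_nhdsGT (by linarith)
  have hn : ∀ y : ℝ, 1 < y → ‖(y : ℂ) * ζ‖ = y := fun y hy => by
    rw [norm_mul, hζ, mul_one, Complex.norm_real, Real.norm_of_nonneg (by linarith)]
  have hp : Tendsto (fun y : ℝ => positiveTail c κ (y * ζ)) (𝓝[>] 1) (𝓝 (positiveTail c κ ζ)) := by
    refine tendsto_tsum_of_dominated_convergence
      (bound := fun l : ℕ => c⁻¹ * (((1 + κ) / 2) / κ) ^ l)
      (summable_const_mul_geometric (by positivity) ((div_lt_one hκ0).2 (by linarith)))
      (fun l => (hcont.pow l).div_const _) ?_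
    filter_upwards [hev] with y hy l
    refine (norm_positiveTail_term hc hκ _ l).trans ?_
    rw [hn y hy.1]
    have := hy.2.le
    have := hy.1
    gcongr
  have hm : Tendsto (fun y : ℝ => negativeTail c κ (y * ζ)) (𝓝[>] 1) (𝓝 (negativeTail c κ ζ)) := by
    refine tendsto_tsum_of_dominated_convergence
      (bound := fun k : ℕ => c * κ⁻¹ ^ (k + 1))
      (summable_const_mul_geometric_succ (by positivity) (inv_lt_one_of_one_lt₀ hκ))
      (fun l => ((hcont.inv₀ hζ0).pow (l + 1)).div_const _) ?_
    filter_upwards [hev] with y hy l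
    exact norm_negativeTail_term hc hκ (by rw [hn y hy.1]; exact hy.1.le) l
  have hg : Tendsto (fun y : ℝ => 1 / ((y : ℂ) * ζ - 1)) (𝓝[>] 1) (𝓝 (1 / (ζ - 1))) :=
    tendsto_const_nhds.div (hcont.sub_const 1) (sub_ne_zero.2 hζ1)
  refine ((hg.add hp).sub hm).congr' ?_
  filter_upwards [hev] with y hy
  exact (bilateral_tsum hc hκ (by rw [hn y hy.1]; exact hy.1)
    (by rw [hn y hy.1]; linarith [hy.2])).symm

/-! ### Positivity of the masses and the bound on `σ⋆`. -/

section Sigma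

variable {b r₁ r₂ : ℝ}

lemma sub_one_lt_mul_log {y : ℝ} (h1 : 1 < y) : y - 1 < y * Real.log y := by
  have h := Real.log_lt_sub_one_of_pos (x := y⁻¹) (by positivity) (by
    intro h; rw [inv_eq_one] at h; linarith)
  rw [Real.log_inv] at h
  have : y * y⁻¹ = 1 := mul_inv_cancel₀ (by linarith)
  nlinarith

/-- With `Y = (r₂/r₁)^{2b}` the two claims are `log Y < Y - 1` and `Y - 1 < Y log Y`. -/
lemma sigma_pos (hb : 0 < b) (hr₁ : 0 < r₁) (hr₁₂ : r₁ < r₂) :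
    0 < sigma₁ b r₁ r₂ ∧ 0 < sigma₂ b r₁ r₂ := by
  have hr₂ : 0 < r₂ := hr₁.trans hr₁₂
  have hy : 1 < r₂ / r₁ := (one_lt_div hr₁).2 hr₁₂
  have hl : 0 < Real.log (r₂ / r₁) := Real.log_pos hy
  set R := r₁ ^ (2 * b) with hR
  have hRpos : 0 < R := by positivity
  set Y := (r₂ / r₁) ^ (2 * b) with hY
  have hR2 : r₂ ^ (2 * b) = R * Y := by
    rw [hY, Real.div_rpow hr₂.le hr₁.le, ← hR]; field_simp
  have hlog : Real.log Y = 2 * b * Real.log (r₂ / r₁) := Real.log_rpow (by positivity) _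
  have hY1 : 1 < Y := Real.one_lt_rpow hy (by linarith)
  have k1 := sub_one_lt_mul_log hY1
  have k2 := Real.log_lt_sub_one_of_pos (x := Y) (by linarith) hY1.ne'
  rw [hlog] at k1 k2
  constructor
  · rw [sigma₁, sigmaStar, hR2, sub_pos, lt_div_iff₀ (by positivity), ← hR]
    nlinarith
  · rw [sigma₂, sigmaStar, hR2, sub_pos, div_lt_iff₀ (by positivity), ← hR]
    nlinarith

lemma sigmaStar_pos (hr₁ : 0 < r₁) (hr₁₂ : r₁ < r₂) (hb : 0 < b) : 0 < sigmaStar b r₁ r₂ := by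
  have := (sigma_pos hb hr₁ hr₁₂).1
  have h2 : 0 < b * r₁ ^ (2 * b) := by positivity
  rw [sigma₁] at this; linarith

/-- Positivity of `σ₂` gives `σ⋆ < b r₂^{2b}`, and `r₂ < b^{-1/(2b)}` makes this less than `1`. The
critical index thus lies below `n` by a margin of order `n`. -/
lemma sigmaStar_lt_one (hb : 0 < b) (hr₁ : 0 < r₁) (hr₁₂ : r₁ < r₂)
    (hr₂ : r₂ < b ^ (-(1 / (2 * b)))) : sigmaStar b r₁ r₂ < 1 := by
  have h := (sigma_pos hb hr₁ hr₁₂).2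
  have h2 : r₂ ^ (2 * b) < b⁻¹ := by
    have := Real.rpow_lt_rpow (hr₁.trans hr₁₂).le hr₂ (z := 2 * b) (by positivity)
    rwa [← Real.rpow_mul hb.le, show -(1 / (2 * b)) * (2 * b) = -1 by field_simp,
      Real.rpow_neg_one] at this
  have h3 : b * r₂ ^ (2 * b) < 1 := by
    calc b * r₂ ^ (2 * b) < b * b⁻¹ := by gcongr
      _ = 1 := mul_inv_cancel₀ hb.ne'
  rw [sigma₂] at h; linarith

end Sigma

/-! ### The Abel limit of the oscillatory Szegő kernel. -/

/-- The constant `(σ₁ / σ₂) (r₂ / r₁) ^ (2 (1 - x))` of the oscillatory Szegő kernel. -/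
noncomputable def ratioConst (b α r₁ r₂ : ℝ) (n : ℕ) : ℝ :=
  sigma₁ b r₁ r₂ / sigma₂ b r₁ r₂ * (r₂ / r₁) ^ (2 * (1 - xFrac b α r₁ r₂ n))

/-- The regularised bilateral sum at the unimodular point `ζ`. -/
noncomputable def regSum (b α r₁ r₂ : ℝ) (n : ℕ) (ζ : ℂ) : ℂ :=
  1 / (ζ - 1) + positiveTail (ratioConst b α r₁ r₂ n) ((r₂ / r₁) ^ 2) ζ
    - negativeTail (ratioConst b α r₁ r₂ n) ((r₂ / r₁) ^ 2) ζ

lemma norm_exp_I_mul (t : ℝ) : ‖Complex.exp (Complex.I * t)‖ = 1 := by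
  rw [mul_comm, Complex.norm_exp_ofReal_mul_I]

lemma exp_I_mul_ne_one {t : ℝ} (h : ∀ k : ℤ, t ≠ 2 * Real.pi * k) :
    Complex.exp (Complex.I * t) ≠ 1 := by
  intro h1
  obtain ⟨k, hk⟩ := Complex.exp_eq_one_iff.1 h1
  apply h k
  have : (t : ℂ) = 2 * Real.pi * k := by
    have hI := Complex.I_ne_zero
    apply mul_left_cancel₀ hI
    rw [hk]; ring
  exact_mod_cast this

/-- Factoring `(r₁²)^l r₁^{2(1-x)}/σ₁` out of each denominator gives the model series at `yζ` with
`y = r²/r₁² ↘ 1`, to which `bilateral_abel` applies. -/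
lemma tendsto_szego {b α r₁ r₂ : ℝ} (hb : 0 < b) (hr₁ : 0 < r₁) (hr₁₂ : r₁ < r₂)
    {θ₁ θ₂ : ℝ} (hθ : ∀ k : ℤ, θ₁ - θ₂ ≠ 2 * Real.pi * k) (n : ℕ) :
    Tendsto
      (fun r : ℝ => szego b α r₁ r₂ n
        (r * Complex.exp (Complex.I * θ₁)) (r * Complex.exp (Complex.I * θ₂)))
      (𝓝[>] r₁) (𝓝 (1 / (2 * Real.pi) *
        ((sigma₁ b r₁ r₂ / r₁ ^ (2 * (1 - xFrac b α r₁ r₂ n)) : ℝ) : ℂ) *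
          regSum b α r₁ r₂ n (Complex.exp (Complex.I * (θ₁ - θ₂))))) := by
  have hr₂ : 0 < r₂ := hr₁.trans hr₁₂
  obtain ⟨hs1, hs2⟩ := sigma_pos hb hr₁ hr₁₂
  have hc : 0 < ratioConst b α r₁ r₂ n := by rw [ratioConst]; positivity
  have hκ : 1 < (r₂ / r₁) ^ 2 := one_lt_pow₀ ((one_lt_div hr₁).2 hr₁₂) (by norm_num)
  have hζe : Complex.exp (Complex.I * (θ₁ - θ₂)) = Complex.exp (Complex.I * (θ₁ - θ₂ : ℝ)) := by
    push_cast; rfl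
  have hA := bilateral_abel hc hκ (ζ := Complex.exp (Complex.I * (θ₁ - θ₂)))
    (by rw [hζe]; exact norm_exp_I_mul _) (by rw [hζe]; exact exp_I_mul_ne_one hθ)
  have hy : Tendsto (fun r : ℝ => r ^ 2 / r₁ ^ 2) (𝓝[>] r₁) (𝓝[>] 1) := by
    refine tendsto_nhdsWithin_iff.2 ⟨?_, ?_⟩
    · have : Continuous fun r : ℝ => r ^ 2 / r₁ ^ 2 := by fun_prop
      have h := this.tendsto r₁
      rw [div_self (by positivity)] at h
      exact h.mono_left nhdsWithin_le_nhds
    · filter_upwards [self_mem_nhdsWithin] with r hr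
      have hr : r₁ < r := hr
      have h1 : (0 : ℝ) < r₁ ^ 2 := by positivity
      have h2 : r₁ ^ 2 < r ^ 2 := by gcongr
      exact (one_lt_div h1).2 h2
  refine ((hA.comp hy).const_mul _).congr fun r => ?_
  rw [szego, mul_assoc]
  congr 1
  rw [Function.comp_apply, ← tsum_mul_left]
  refine tsum_congr fun l => ?_
  have hzw : (r * Complex.exp (Complex.I * θ₁)) *
      (starRingEnd ℂ) ((r : ℂ) * Complex.exp (Complex.I * θ₂)) =
      ((r₁ ^ 2 : ℝ) : ℂ) *
        ((r ^ 2 / r₁ ^ 2 : ℝ) * Complex.exp (Complex.I * (θ₁ - θ₂))) := by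
    rw [map_mul, Complex.conj_ofReal, ← Complex.exp_conj, map_mul, Complex.conj_I,
      Complex.conj_ofReal,
      show Complex.I * ((θ₁ : ℂ) - θ₂) = Complex.I * θ₁ + -Complex.I * θ₂ by ring,
      Complex.exp_add]
    have : (r₁ : ℂ) ≠ 0 := by exact_mod_cast hr₁.ne'
    push_cast
    field_simp
  rw [hzw, mul_zpow ((r₁ ^ 2 : ℝ) : ℂ)]
  set W := (((r ^ 2 / r₁ ^ 2 : ℝ) : ℂ) * Complex.exp (Complex.I * (θ₁ - θ₂))) ^ l
  set x := xFrac b α r₁ r₂ n with hx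
  have e1 : r₁ ^ (2 * ((l : ℝ) + 1 - x)) = (r₁ ^ 2) ^ l * r₁ ^ (2 * (1 - x)) := by
    rw [← Real.rpow_intCast, ← Real.rpow_natCast, ← Real.rpow_mul hr₁.le, ← Real.rpow_add hr₁]
    congr 1; push_cast; ring
  have e2 : r₂ ^ (2 * ((l : ℝ) + 1 - x)) = (r₂ ^ 2) ^ l * r₂ ^ (2 * (1 - x)) := by
    rw [← Real.rpow_intCast, ← Real.rpow_natCast, ← Real.rpow_mul hr₂.le, ← Real.rpow_add hr₂]
    congr 1; push_cast; ring
  have e3 : r₁ ^ (2 * ((l : ℝ) + 1 - x)) / sigma₁ b r₁ r₂ + r₂ ^ (2 * ((l : ℝ) + 1 - x)) / sigma₂ b r₁ r₂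
      = (r₁ ^ 2) ^ l * (r₁ ^ (2 * (1 - x)) / sigma₁ b r₁ r₂) *
        (1 + ratioConst b α r₁ r₂ n * ((r₂ / r₁) ^ 2) ^ l) := by
    rw [e1, e2, ratioConst, ← hx, div_pow, div_zpow, Real.div_rpow hr₂.le hr₁.le]
    field_simp
  rw [e3]
  have hne : ((r₁ ^ 2 : ℝ) : ℂ) ^ l ≠ 0 := zpow_ne_zero _ (by exact_mod_cast (by positivity))
  have hr1p : ((r₁ ^ (2 * (1 - x)) : ℝ) : ℂ) ≠ 0 := by exact_mod_cast (by positivity)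
  have hsc : (sigma₁ b r₁ r₂ : ℂ) ≠ 0 := by exact_mod_cast hs1.ne'
  have halg : ∀ P K s D W : ℂ, P ≠ 0 → K ≠ 0 → s ≠ 0 →
      s / K * (W / D) = P * W / (P * (K / s) * D) := by
    intro P K s D W hP hK hs; field_simp
  have hcast : ∀ P K s D : ℝ, ((P ^ l * (K / s) * D : ℝ) : ℂ) = (P : ℂ) ^ l * (K / s) * D := by
    intro P K s D; push_cast; rfl
  rw [hcast, Complex.ofReal_div (sigma₁ b r₁ r₂)]
  exact halg _ _ _ _ _ hne hr1p hsc

lemma szegoReg_eq {b α r₁ r₂ : ℝ} (hb : 0 < b) (hr₁ : 0 < r₁) (hr₁₂ : r₁ < r₂)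
    {θ₁ θ₂ : ℝ} (hθ : ∀ k : ℤ, θ₁ - θ₂ ≠ 2 * Real.pi * k) (n : ℕ) :
    szegoReg b α r₁ r₂ n θ₁ θ₂ = 1 / (2 * Real.pi) *
        ((sigma₁ b r₁ r₂ / r₁ ^ (2 * (1 - xFrac b α r₁ r₂ n)) : ℝ) : ℂ) *
          regSum b α r₁ r₂ n (Complex.exp (Complex.I * (θ₁ - θ₂))) :=
  (tendsto_szego hb hr₁ hr₁₂ hθ n).limUnder_eq

lemma regSum_eq {b α r₁ r₂ : ℝ} (hr₁ : 0 < r₁) (hr₁₂ : r₁ < r₂)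
    (n : ℕ) (t : ℂ) :
    regSum b α r₁ r₂ n (Complex.exp (Complex.I * t)) =
      1 / (Complex.exp (Complex.I * t) - 1)
          + ∑' l : ℕ, Complex.exp (Complex.I * t * l) /
              ((1 + sigma₁ b r₁ r₂ / sigma₂ b r₁ r₂ *
                (r₂ / r₁) ^ (2 * ((l : ℝ) + 1 - xFrac b α r₁ r₂ n)) : ℝ) : ℂ)
          - ∑' l : ℕ, Complex.exp (Complex.I * t * (-((l : ℂ) + 1))) /
              ((1 + sigma₂ b r₁ r₂ / sigma₁ b r₁ r₂ *
                (r₁ / r₂) ^ (2 * (-((l : ℝ) + 1) + 1 - xFrac b α r₁ r₂ n)) : ℝ) : ℂ) := by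
  have hr₂ : 0 < r₂ := hr₁.trans hr₁₂
  have hk : 0 < r₂ / r₁ := by positivity
  rw [regSum, positiveTail, negativeTail]
  congr 2
  · refine tsum_congr fun l => ?_
    congr 2
    · rw [← Complex.exp_nat_mul]; ring_nf
    · rw [ratioConst, mul_assoc, ← Real.rpow_natCast, ← Real.rpow_natCast, ← Real.rpow_mul hk.le,
        ← Real.rpow_add hk]
      congr 3; push_cast; ring
  · ext l
    congr 2
    · rw [← Complex.exp_neg, ← Complex.exp_nat_mul]; push_cast; ring_nf
    · rw [ratioConst, mul_inv, inv_div, mul_assoc, ← Real.rpow_neg hk.le, ← Real.rpow_natCast,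
        ← Real.rpow_natCast, ← Real.rpow_mul hk.le, ← Real.rpow_add hk,
        ← inv_div r₂ r₁, Real.inv_rpow hk.le, ← Real.rpow_neg hk.le]
      congr 3; push_cast; ring

/-! ### Perturbed finite sums compared with the two tails. -/

/-- Here `m` is the exponential rate, known to be `nσ` up to `Y`, and `E` measures the second-order
Laplace correction; each contributes its own term to the error. -/
lemma abs_mul_sub_one_le {σ n m Y E G : ℝ} (hσ : 0 < σ) (hn : 0 < n) (hm : n * σ / 2 ≤ m)
    (hY : |m - n * σ| ≤ Y) (hE : 0 ≤ E) (hlow : 1 / m - n * E / m ^ 3 ≤ G) (hup : G ≤ 1 / m) :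
    |σ * n * G - 1| ≤ (2 / σ * Y + 8 * E / σ ^ 2) / n := by
  have hnσ : 0 < n * σ := mul_pos hn hσ
  have hm0 : 0 < m := by linarith
  have hY0 : 0 ≤ Y := (abs_nonneg _).trans hY
  have h1 : |σ * n / m - 1| ≤ 2 / σ * Y / n := by
    have : σ * n / m - 1 = -(m - n * σ) / m := by field_simp; ring
    rw [this, abs_div, abs_neg, abs_of_pos hm0]
    calc |m - n * σ| / m ≤ Y / (n * σ / 2) := by gcongr
      _ = _ := by field_simp
  have h2 : σ * n * (n * E / m ^ 3) ≤ 8 * E / σ ^ 2 / n := by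
    calc σ * n * (n * E / m ^ 3) ≤ σ * n * (n * E / (n * σ / 2) ^ 3) := by gcongr
      _ = _ := by field_simp; norm_num
  have hsn : 0 ≤ σ * n := by positivity
  have h3 := mul_le_mul_of_nonneg_left hlow hsn
  have h4 := mul_le_mul_of_nonneg_left hup hsn
  have e1 : σ * n * (1 / m) = σ * n / m := by ring
  rw [mul_sub, e1] at h3
  rw [e1] at h4
  have h0 : 0 ≤ 8 * E / σ ^ 2 / n := by positivity
  rw [add_div]
  rw [abs_le] at h1 ⊢
  constructor <;> linarith [h1.1, h1.2]

/-- The gain `1/a` matters: it is summable above the critical index, where `a` grows geometrically.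
-/
lemma abs_inv_sub_inv_le {g lam a ε : ℝ} (hg : 0 ≤ g) (hl : 1 / 2 ≤ lam) (ha : 0 < a)
    (h1 : |g - 1| ≤ ε) (h2 : |lam - 1| ≤ ε) :
    |1 / (g + a * lam) - 1 / (1 + a)| ≤ 2 * ε / a := by
  have hd : 0 < g + a * lam := by nlinarith
  have hd' : a / 2 ≤ g + a * lam := by nlinarith
  have e : 1 / (g + a * lam) - 1 / (1 + a) =
      -((g - 1) + a * (lam - 1)) / ((g + a * lam) * (1 + a)) := by field_simp; ring
  have hε : 0 ≤ ε := (abs_nonneg _).trans h1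
  rw [e, abs_div, abs_neg, abs_of_pos (by positivity : 0 < (g + a * lam) * (1 + a))]
  have hnum : |(g - 1) + a * (lam - 1)| ≤ ε * (1 + a) := by
    refine (abs_add_le _ _).trans ?_
    rw [abs_mul, abs_of_pos ha]
    nlinarith
  calc _ ≤ ε * (1 + a) / (a / 2 * (1 + a)) := by gcongr
    _ = _ := by field_simp

/-- The counterpart below the critical index, where `a` decays and the error must be proportional to
`a`. -/
lemma abs_ratio_sub_le {g lam a ε : ℝ} (hg : 1 / 2 ≤ g) (hg2 : g ≤ 2) (hl : 0 ≤ lam)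
    (hl2 : lam ≤ 2) (ha : 0 < a) (h1 : |g - 1| ≤ ε) (h2 : |lam - 1| ≤ ε) :
    |a * lam / (g * (g + a * lam)) - a / (1 + a)| ≤ 16 * a * ε := by
  have hε : 0 ≤ ε := (abs_nonneg _).trans h1
  have hd : 1 / 2 ≤ g + a * lam := by nlinarith [mul_nonneg ha.le hl]
  have hd0 : 0 < g + a * lam := by linarith
  have hg0 : 0 < g := by linarith
  have e : a * lam / (g * (g + a * lam)) - a / (1 + a) =
      a * ((lam - 1) + (1 + g) * (1 - g) + a * lam * (1 - g)) / (g * (g + a * lam) * (1 + a)) := by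
    field_simp; ring
  rw [e, abs_div, abs_of_pos (by positivity : 0 < g * (g + a * lam) * (1 + a)), abs_mul,
    abs_of_pos ha]
  have h1' : |1 - g| ≤ ε := by rwa [abs_sub_comm]
  have hnum : |(lam - 1) + (1 + g) * (1 - g) + a * lam * (1 - g)| ≤ 4 * ε * (1 + a) := by
    refine (abs_add_three _ _ _).trans ?_
    rw [abs_mul, abs_mul, abs_of_pos (by linarith : 0 < 1 + g), abs_of_nonneg (by positivity : 0 ≤ a * lam)]
    have k1 : (1 + g) * |1 - g| ≤ 3 * ε := by gcongr; linarith
    have k2 : a * lam * |1 - g| ≤ a * 2 * ε := by gcongr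
    nlinarith [mul_nonneg ha.le hε]
  calc a * |(lam - 1) + (1 + g) * (1 - g) + a * lam * (1 - g)| / (g * (g + a * lam) * (1 + a))
      ≤ a * (4 * ε * (1 + a)) / (1 / 2 * (1 / 2) * (1 + a)) := by gcongr
    _ = _ := by field_simp; ring

lemma summable_succ_mul_geometric {ρ : ℝ} (h0 : 0 ≤ ρ) (h1 : ρ < 1) :
    Summable fun l : ℕ => (1 + (l : ℝ)) * ρ ^ l := by
  have h := (summable_pow_mul_geometric_of_norm_lt_one 1
    (by rwa [Real.norm_of_nonneg h0] : ‖ρ‖ < 1)).add (summable_geometric_of_lt_one h0 h1)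
  refine h.congr fun l => ?_
  simp; ring

/-- A finite sum is close to a series if the summands are, with a geometrically small weight. -/
lemma norm_sum_range_sub_tsum_le {f g : ℕ → ℂ} {K ρ : ℝ} {M : ℕ} (h0 : 0 ≤ ρ) (h1 : ρ < 1)
    (hg : Summable g) (hnear : ∀ l < M, ‖f l - g l‖ ≤ K * ((1 + l) * ρ ^ l))
    (hfar : ∀ l, M ≤ l → ‖g l‖ ≤ K * ((1 + l) * ρ ^ l)) :
    ‖∑ l ∈ Finset.range M, f l - ∑' l, g l‖ ≤ K * ∑' l : ℕ, (1 + (l : ℝ)) * ρ ^ l := by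
  have hs := (summable_succ_mul_geometric h0 h1).mul_left K
  set F : ℕ → ℂ := fun l => if l < M then f l else 0 with hF
  have hFs : HasSum F (∑ l ∈ Finset.range M, f l) := by
    have h : ∑ l ∈ Finset.range M, f l = ∑ l ∈ Finset.range M, F l :=
      Finset.sum_congr rfl fun l hl => by simp [hF, Finset.mem_range.1 hl]
    rw [h]
    refine hasSum_sum_of_ne_finset_zero fun l hl => ?_
    have : ¬ l < M := by simpa using hl
    simp [hF, this]
  have hd : ∀ l, ‖F l - g l‖ ≤ K * ((1 + l) * ρ ^ l) := by
    intro l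
    by_cases h : l < M
    · simpa [hF, h] using hnear l h
    · simpa [hF, h] using hfar l (not_lt.1 h)
  have hsub := hFs.sub hg.hasSum
  rw [← hsub.tsum_eq, ← tsum_mul_left]
  exact tsum_of_norm_bounded hs.hasSum hd

lemma one_sub_pow_le {q : ℝ} (h0 : 0 ≤ q) (l : ℕ) : 1 - q ^ l ≤ l * (1 - q) := by
  have := one_add_mul_le_pow (a := q - 1) (by linarith) l
  rw [show (1 : ℝ) + (q - 1) = q by ring] at this
  linarith

/-- For `l ≤ δn` the terms are compared directly. For `l > δn` both are `O(κ^{-l})`, and `1 ≤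
(1+l)/(δn)` puts the trivial bound into the same form `(1+l)κ^{-l}/n`; the `3` there is `2 + 1` from
the two terms. -/
lemma upper_sum_le {κ c₀ c C δ n q : ℝ} {ζ : ℂ} {M : ℕ} {g lam : ℕ → ℝ} (hκ : 1 < κ)
    (hc₀ : 0 < c₀) (hc : c₀ ≤ c) (hC : 0 ≤ C) (hδ : 0 < δ) (hn : 0 < n) (hζ : ‖ζ‖ = 1)
    (hq0 : 0 ≤ q) (hq1 : q ≤ 1) (hq : 1 - q ≤ C / n)
    (hg : ∀ l < M, 0 ≤ g l) (hl : ∀ l < M, 1 / 2 ≤ lam l)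
    (hM : ∀ l : ℕ, (l : ℝ) ≤ δ * n → l < M)
    (hg1 : ∀ l : ℕ, (l : ℝ) ≤ δ * n → |g l - 1| ≤ C * (1 + l) / n)
    (hl1 : ∀ l : ℕ, (l : ℝ) ≤ δ * n → |lam l - 1| ≤ C * (1 + l) / n) :
    ‖∑ l ∈ Finset.range M, (q * ζ) ^ l / ((g l + c * κ ^ l * lam l : ℝ) : ℂ)
        - positiveTail c κ ζ‖ ≤
      ((4 * C + 3 / δ) / c₀ / n) * ∑' l : ℕ, (1 + (l : ℝ)) * κ⁻¹ ^ l := by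
  have hκ0 : 0 < κ := by linarith
  have hcpos : 0 < c := hc₀.trans_le hc
  have hκi : κ⁻¹ < 1 := inv_lt_one_of_one_lt₀ hκ
  have hfarK : ∀ l : ℕ, ¬ (l : ℝ) ≤ δ * n →
      3 / (c * κ ^ l) ≤ (4 * C + 3 / δ) / c₀ / n * ((1 + l) * κ⁻¹ ^ l) := by
    intro l h
    have h1 : 1 ≤ (1 + l) / (δ * n) := by
      rw [one_le_div (by positivity)]; linarith
    have h2 : 3 / (c * κ ^ l) ≤ 3 / (c₀ * κ ^ l) := by gcongr
    refine h2.trans ?_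
    calc 3 / (c₀ * κ ^ l) ≤ 3 / (c₀ * κ ^ l) * ((1 + l) / (δ * n)) :=
          le_mul_of_one_le_right (by positivity) h1
      _ = (3 / δ) / c₀ / n * ((1 + l) * κ⁻¹ ^ l) := by rw [inv_pow]; field_simp
      _ ≤ _ := by gcongr; linarith
  have hFinf : ∀ l : ℕ, ‖ζ ^ l / ((1 + c * κ ^ l : ℝ) : ℂ)‖ ≤ 1 / (c * κ ^ l) := by
    intro l
    refine (norm_div_one_add (by positivity) _).trans_eq ?_
    rw [norm_pow, hζ, one_pow]
  refine norm_sum_range_sub_tsum_le (by positivity) hκi ?_ (fun l hlM => ?_) (fun l hlM => ?_)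
  · refine Summable.of_norm_bounded (summable_const_mul_geometric (C := c⁻¹) (ρ := ‖ζ‖ / κ)
      (by positivity) ((div_lt_one hκ0).2 (by rw [hζ]; exact hκ)))
      fun l => norm_positiveTail_term hcpos hκ ζ l
  · set a := c * κ ^ l with ha
    have hapos : 0 < a := by positivity
    have hgl := hg l hlM
    have hll := hl l hlM
    have hden : a / 2 ≤ g l + a * lam l := by nlinarith
    have hden0 : 0 < g l + a * lam l := by linarith
    have hden' : 1 / (g l + a * lam l) ≤ 2 / a := by
      calc 1 / (g l + a * lam l) ≤ 1 / (a / 2) := by gcongr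
        _ = _ := by field_simp
    by_cases h : (l : ℝ) ≤ δ * n
    · have e : (q * ζ) ^ l / ((g l + a * lam l : ℝ) : ℂ) - ζ ^ l / ((1 + a : ℝ) : ℂ) =
          ζ ^ l * (((q ^ l - 1) * (1 / (g l + a * lam l)) +
            (1 / (g l + a * lam l) - 1 / (1 + a)) : ℝ) : ℂ) := by
        push_cast; rw [mul_pow]; ring
      rw [e, norm_mul, norm_pow, hζ, one_pow, one_mul, Complex.norm_real, Real.norm_eq_abs]
      refine (abs_add_le _ _).trans ?_
      have k1 := abs_inv_sub_inv_le hgl hll hapos (hg1 l h) (hl1 l h)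
      have k2 : |(q ^ l - 1) * (1 / (g l + a * lam l))| ≤ l * (C / n) * (2 / a) := by
        rw [abs_mul, abs_of_pos (by positivity : 0 < 1 / (g l + a * lam l)), abs_sub_comm,
          abs_of_nonneg (sub_nonneg.2 (pow_le_one₀ hq0 hq1))]
        have := one_sub_pow_le hq0 l
        have k3 : 1 - q ^ l ≤ l * (C / n) := this.trans (by gcongr)
        gcongr
      calc _ ≤ l * (C / n) * (2 / a) + 2 * (C * (1 + l) / n) / a := add_le_add k2 k1
        _ ≤ (1 + l) * (C / n) * (2 / a) + 2 * (C * (1 + l) / n) / a := by gcongr; linarith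
        _ = 4 * C / n * (1 + l) / a := by field_simp; ring
        _ ≤ 4 * C / n * (1 + l) / (c₀ * κ ^ l) := by rw [ha]; gcongr
        _ = 4 * C / c₀ / n * ((1 + l) * κ⁻¹ ^ l) := by rw [inv_pow]; field_simp
        _ ≤ _ := by
          gcongr
          have : 0 ≤ 3 / δ := by positivity
          linarith
    · refine le_trans ?_ (hfarK l h)
      refine (norm_sub_le _ _).trans ?_
      have k1 : ‖(q * ζ) ^ l / ((g l + a * lam l : ℝ) : ℂ)‖ ≤ 2 / a := by
        rw [norm_div, norm_pow, norm_mul, hζ, mul_one, Complex.norm_real, Complex.norm_real,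
          Real.norm_of_nonneg hq0, Real.norm_of_nonneg hden0.le]
        refine le_trans ?_ hden'
        gcongr
        exact pow_le_one₀ hq0 hq1
      calc _ ≤ 2 / a + 1 / a := add_le_add k1 (hFinf l)
        _ = 3 / a := by ring
  · have h : ¬ (l : ℝ) ≤ δ * n := fun h => absurd (hM l h) (not_lt.2 hlM)
    refine (hFinf l).trans (le_trans ?_ (hfarK l h))
    gcongr; norm_num

/-- The same near/far division, indexed downwards from the critical index. Negative powers of `q`
exceed `1` and are controlled by `Q`; far from the critical index only the crude bounds `g₀` and
`Lam` are used. -/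
lemma lower_sum_le {κ c₁ c C δ n q Q g₀ Lam : ℝ} {ζ : ℂ} {M : ℕ} {g lam : ℕ → ℝ} (hκ : 1 < κ)
    (hcpos : 0 < c) (hc : c ≤ c₁) (hC : 0 ≤ C) (hδ : 0 < δ) (hn : 0 < n) (hζ : ‖ζ‖ = 1)
    (hq0 : 0 < q) (hq1 : q ≤ 1) (hq : 1 - q ≤ C / n) (hQ : ∀ k < M, q⁻¹ ^ (k + 1) ≤ Q)
    (hg₀ : 0 < g₀)
    (hg : ∀ k < M, g₀ ≤ g k) (hl : ∀ k < M, 0 ≤ lam k) (hl' : ∀ k < M, lam k ≤ Lam)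
    (hM : ∀ k : ℕ, (k : ℝ) ≤ δ * n → k < M)
    (hg2 : ∀ k : ℕ, (k : ℝ) ≤ δ * n → 1 / 2 ≤ g k ∧ g k ≤ 2)
    (hl2 : ∀ k : ℕ, (k : ℝ) ≤ δ * n → lam k ≤ 2)
    (hg1 : ∀ k : ℕ, (k : ℝ) ≤ δ * n → |g k - 1| ≤ C * (1 + k) / n)
    (hl1 : ∀ k : ℕ, (k : ℝ) ≤ δ * n → |lam k - 1| ≤ C * (1 + k) / n) :
    ‖∑ k ∈ Finset.range M, (q * ζ)⁻¹ ^ (k + 1) *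
        ((c * κ⁻¹ ^ (k + 1) * lam k / (g k * (g k + c * κ⁻¹ ^ (k + 1) * lam k)) : ℝ) : ℂ)
        - negativeTail c κ ζ‖ ≤
      ((8 * Q * C + 16 * C + (Q * Lam / g₀ ^ 2 + 1) / δ) * c₁ / n) *
        ∑' l : ℕ, (1 + (l : ℝ)) * κ⁻¹ ^ l := by
  have hκ0 : 0 < κ := by linarith
  have hκi : κ⁻¹ < 1 := inv_lt_one_of_one_lt₀ hκ
  have hc₁ : 0 < c₁ := hcpos.trans_le hc
  have hM0 : 0 < M := hM 0 (by simpa using by positivity)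
  have hQ0 : 0 ≤ Q := le_trans (by positivity) (hQ 0 hM0)
  have hLam0 : 0 ≤ Lam := (hl 0 hM0).trans (hl' 0 hM0)
  have hterm : ∀ k : ℕ, ζ⁻¹ ^ (k + 1) / ((1 + c⁻¹ * κ ^ (k + 1) : ℝ) : ℂ) =
      ζ⁻¹ ^ (k + 1) * ((c * κ⁻¹ ^ (k + 1) / (1 + c * κ⁻¹ ^ (k + 1)) : ℝ) : ℂ) := by
    intro k
    have : (1 + c⁻¹ * κ ^ (k + 1))⁻¹ = c * κ⁻¹ ^ (k + 1) / (1 + c * κ⁻¹ ^ (k + 1)) := by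
      rw [inv_pow]
      have : 0 < κ ^ (k + 1) := by positivity
      field_simp
      ring
    rw [← this, div_eq_mul_inv, Complex.ofReal_inv]
  have hak : ∀ k : ℕ, c * κ⁻¹ ^ (k + 1) ≤ c₁ * κ⁻¹ ^ k := by
    intro k
    have : κ⁻¹ ^ (k + 1) ≤ κ⁻¹ ^ k := pow_le_pow_of_le_one (by positivity) hκi.le (Nat.le_succ k)
    gcongr
  have hζi : ‖ζ⁻¹‖ = 1 := by rw [norm_inv, hζ, inv_one]
  have hfar : ∀ k : ℕ, ¬ (k : ℝ) ≤ δ * n →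
      (Q * Lam / g₀ ^ 2 + 1) * (c * κ⁻¹ ^ (k + 1)) ≤
      (8 * Q * C + 16 * C + (Q * Lam / g₀ ^ 2 + 1) / δ) * c₁ / n * ((1 + k) * κ⁻¹ ^ k) := by
    intro k h
    have h1 : 1 ≤ (1 + k) / (δ * n) := by
      rw [one_le_div (by positivity)]; linarith
    calc (Q * Lam / g₀ ^ 2 + 1) * (c * κ⁻¹ ^ (k + 1))
        ≤ (Q * Lam / g₀ ^ 2 + 1) * (c₁ * κ⁻¹ ^ k) := by gcongr ?_ * ?_; exact hak k
      _ ≤ (Q * Lam / g₀ ^ 2 + 1) * (c₁ * κ⁻¹ ^ k) * ((1 + k) / (δ * n)) :=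
          le_mul_of_one_le_right (by positivity) h1
      _ = (Q * Lam / g₀ ^ 2 + 1) / δ * c₁ / n * ((1 + k) * κ⁻¹ ^ k) := by field_simp
      _ ≤ _ := by
        gcongr
        have : 0 ≤ 8 * Q * C + 16 * C := by positivity
        linarith
  have hFinf : ∀ k : ℕ, ‖ζ⁻¹ ^ (k + 1) / ((1 + c⁻¹ * κ ^ (k + 1) : ℝ) : ℂ)‖ ≤
      c * κ⁻¹ ^ (k + 1) := fun k => norm_negativeTail_term hcpos hκ hζ.ge k
  refine norm_sum_range_sub_tsum_le (by positivity) hκi ?_ (fun k hkM => ?_) (fun k hkM => ?_)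
  · exact Summable.of_norm_bounded (summable_const_mul_geometric_succ (C := c) (ρ := κ⁻¹)
      (by positivity) hκi) hFinf
  · have hFk := hFinf k
    rw [hterm] at hFk ⊢
    have hakk := hak k
    set a := c * κ⁻¹ ^ (k + 1) with ha
    have hapos : 0 < a := by positivity
    have hgl := hg k hkM
    have hgpos : 0 < g k := hg₀.trans_le hgl
    have hll := hl k hkM
    have hden0 : 0 < g k + a * lam k := by positivity
    by_cases h : (k : ℝ) ≤ δ * n
    · have e : (q * ζ)⁻¹ ^ (k + 1) * ((a * lam k / (g k * (g k + a * lam k)) : ℝ) : ℂ)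
          - ζ⁻¹ ^ (k + 1) * ((a / (1 + a) : ℝ) : ℂ) =
          ζ⁻¹ ^ (k + 1) * (((q⁻¹ ^ (k + 1) - 1) * (a * lam k / (g k * (g k + a * lam k))) +
            (a * lam k / (g k * (g k + a * lam k)) - a / (1 + a)) : ℝ) : ℂ) := by
        rw [mul_inv, mul_pow]; push_cast; ring
      rw [e, norm_mul, norm_pow, hζi, one_pow, one_mul, Complex.norm_real, Real.norm_eq_abs]
      refine (abs_add_le _ _).trans ?_
      have k1 := abs_ratio_sub_le (hg2 k h).1 (hg2 k h).2 hll (hl2 k h) hapos (hg1 k h) (hl1 k h)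
      have k4 : a * lam k / (g k * (g k + a * lam k)) ≤ 8 * a := by
        have h3 := hl2 k h
        have h4 := (hg2 k h).1
        calc a * lam k / (g k * (g k + a * lam k)) ≤ a * 2 / (1 / 2 * (1 / 2 + 0)) := by
              gcongr; positivity
          _ = 8 * a := by ring
      have k5 : |q⁻¹ ^ (k + 1) - 1| ≤ Q * ((1 + k) * (C / n)) := by
        have h5 : 1 ≤ q⁻¹ ^ (k + 1) := one_le_pow₀ (one_le_inv_iff₀.2 ⟨hq0, hq1⟩)
        rw [abs_of_nonneg (sub_nonneg.2 h5)]
        have h6 : q⁻¹ ^ (k + 1) - 1 = q⁻¹ ^ (k + 1) * (1 - q ^ (k + 1)) := by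
          rw [mul_sub, mul_one, inv_pow, inv_mul_cancel₀ (by positivity)]
        have h7 := one_sub_pow_le hq0.le (k + 1)
        have h8 : 1 - q ^ (k + 1) ≤ (1 + k) * (C / n) := by
          refine h7.trans ?_
          push_cast
          rw [add_comm (k : ℝ)]
          gcongr
        rw [h6]
        have := pow_le_one₀ hq0.le hq1 (n := k + 1)
        exact mul_le_mul (hQ k hkM) h8 (by linarith) hQ0
      have k2 : |(q⁻¹ ^ (k + 1) - 1) * (a * lam k / (g k * (g k + a * lam k)))| ≤
          Q * ((1 + k) * (C / n)) * (8 * a) := by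
        rw [abs_mul, abs_of_nonneg (by positivity : 0 ≤ a * lam k / (g k * (g k + a * lam k)))]
        gcongr
      calc _ ≤ Q * ((1 + k) * (C / n)) * (8 * a) + 16 * a * (C * (1 + k) / n) := add_le_add k2 k1
        _ = (8 * Q * C + 16 * C) / n * (1 + k) * a := by ring
        _ ≤ (8 * Q * C + 16 * C) / n * (1 + k) * (c₁ * κ⁻¹ ^ k) := by gcongr
        _ = (8 * Q * C + 16 * C) * c₁ / n * ((1 + k) * κ⁻¹ ^ k) := by ring
        _ ≤ _ := by
          have : 0 ≤ (Q * Lam / g₀ ^ 2 + 1) / δ := by positivity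
          gcongr ?_ * c₁ / n * _
          exact le_add_of_nonneg_right this
    · refine le_trans ?_ (hfar k h)
      refine (norm_sub_le _ _).trans ?_
      rw [add_mul, one_mul]
      refine add_le_add ?_ hFk
      rw [norm_mul, norm_pow, norm_inv, norm_mul, hζ, mul_one, Complex.norm_real,
        Complex.norm_real, Real.norm_of_nonneg hq0.le, Real.norm_of_nonneg (by positivity)]
      have k4 : a * lam k / (g k * (g k + a * lam k)) ≤ a * Lam / (g₀ * (g₀ + 0)) := by
        have := hl' k hkM
        gcongr
        positivity
      calc _ ≤ Q * (a * Lam / (g₀ * (g₀ + 0))) := mul_le_mul (hQ k hkM) k4 (by positivity) hQ0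
        _ = _ := by rw [add_zero]; ring
  · have h : ¬ (k : ℝ) ≤ δ * n := fun h => absurd (hM k h) (not_lt.2 hkM)
    refine (hFinf k).trans (le_trans ?_ (hfar k h))
    have : 0 ≤ Q * Lam / g₀ ^ 2 := by positivity
    have : 0 ≤ c * κ⁻¹ ^ (k + 1) := by positivity
    nlinarith

/-! ### Summation by parts with convex weights. -/

lemma sub_one_mul_sum (z : ℂ) (β : ℕ → ℂ) (M : ℕ) :
    (z - 1) * ∑ i ∈ Finset.range M, z ^ i * β i =
      z ^ M * β M - β 0 - z * ∑ i ∈ Finset.range M, z ^ i * (β (i + 1) - β i) := by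
  induction M with
  | zero => simp
  | succ M ih => rw [Finset.sum_range_succ, mul_add, ih, Finset.sum_range_succ]; ring

/-- Abel summation, twice, for a convex increasing weight. -/
lemma norm_abel_sum_le {z : ℂ} (hz : ‖z‖ ≤ 1) (hz1 : z ≠ 1) {β : ℕ → ℝ} (h0 : 0 ≤ β 0)
    (hmono : ∀ i, β i ≤ β (i + 1)) (hconv : ∀ i, 2 * β (i + 1) ≤ β i + β (i + 2)) (M : ℕ) :
    ‖(z - 1) * ∑ i ∈ Finset.range M, z ^ i * (β i : ℂ) - z ^ M * (β M : ℂ)‖ ≤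
      β 0 + 2 * (β (M + 1) - β M) / ‖z - 1‖ := by
  have hz1' : 0 < ‖z - 1‖ := norm_pos_iff.2 (sub_ne_zero.2 hz1)
  set D : ℕ → ℝ := fun i => β (i + 1) - β i with hD
  have hD0 : ∀ i, 0 ≤ D i := fun i => sub_nonneg.2 (hmono i)
  have hDm : ∀ i, D i ≤ D (i + 1) := fun i => by have := hconv i; simp only [hD]; linarith
  -- Second summation by parts, applied to the increments. Convexity makes the second differences
  -- nonnegative, so their sum telescopes.
  have hT : ‖∑ i ∈ Finset.range M, z ^ i * (D i : ℂ)‖ ≤ 2 * D M / ‖z - 1‖ := by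
    rw [le_div_iff₀ hz1', mul_comm, ← norm_mul, sub_one_mul_sum z (fun i => (D i : ℂ))]
    have k1 : ‖z ^ M * (D M : ℂ)‖ ≤ D M := by
      rw [norm_mul, norm_pow, Complex.norm_real, Real.norm_of_nonneg (hD0 M)]
      exact mul_le_of_le_one_left (hD0 M) (pow_le_one₀ (norm_nonneg _) hz)
    have k2 : ‖z * ∑ i ∈ Finset.range M, z ^ i * ((D (i + 1) : ℂ) - D i)‖ ≤ D M - D 0 := by
      rw [norm_mul, ← Finset.sum_range_sub D M]
      refine (mul_le_of_le_one_left (norm_nonneg _) hz).trans ?_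
      refine (norm_sum_le _ _).trans (Finset.sum_le_sum fun i _ => ?_)
      rw [norm_mul, norm_pow, ← Complex.ofReal_sub, Complex.norm_real,
        Real.norm_of_nonneg (sub_nonneg.2 (hDm i))]
      exact mul_le_of_le_one_left (sub_nonneg.2 (hDm i)) (pow_le_one₀ (norm_nonneg _) hz)
    have k3 : ‖(D 0 : ℂ)‖ = D 0 := by rw [Complex.norm_real, Real.norm_of_nonneg (hD0 0)]
    calc _ ≤ ‖z ^ M * (D M : ℂ)‖ + ‖(D 0 : ℂ)‖ +
          ‖z * ∑ i ∈ Finset.range M, z ^ i * ((D (i + 1) : ℂ) - D i)‖ :=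
          (norm_sub_le _ _).trans (add_le_add_left (norm_sub_le _ _) _)
      _ ≤ D M + D 0 + (D M - D 0) := by rw [k3]; gcongr
      _ = 2 * D M := by ring
  rw [sub_one_mul_sum z (fun i => (β i : ℂ))]
  have e : z ^ M * (β M : ℂ) - β 0 - z * ∑ i ∈ Finset.range M, z ^ i * ((β (i + 1) : ℂ) - β i)
      - z ^ M * (β M : ℂ) = -((β 0 : ℂ) + z * ∑ i ∈ Finset.range M, z ^ i * (D i : ℂ)) := by
    simp only [hD]; push_cast; ring
  rw [e, norm_neg]
  refine (norm_add_le _ _).trans ?_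
  rw [Complex.norm_real, Real.norm_of_nonneg h0, norm_mul]
  gcongr
  exact (mul_le_of_le_one_left (norm_nonneg _) hz).trans hT

/-- Increments of a convex nonnegative sequence are bounded by its linear growth. -/
lemma increment_le_of_convex {β : ℕ → ℝ} (h0 : ∀ i, 0 ≤ β i)
    (hconv : ∀ i, 2 * β (i + 1) ≤ β i + β (i + 2)) (M : ℕ) {K : ℕ} (hK : 0 < K) :
    β (M + 1) - β M ≤ β (M + K) / K := by
  -- Later increments are no smaller, so the increment at `M` is at most the average over the next
  -- `K` steps.
  have hD : ∀ i, β (M + 1) - β M ≤ β (M + i + 1) - β (M + i) := by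
    intro i
    induction i with
    | zero => simp
    | succ i ih => have := hconv (M + i); rw [← add_assoc]; linarith
  have hsum : ∀ i : ℕ, i * (β (M + 1) - β M) ≤ β (M + i) - β M := by
    intro i
    induction i with
    | zero => simp
    | succ i ih => have := hD i; push_cast; rw [← add_assoc]; linarith
  rw [le_div_iff₀ (by exact_mod_cast hK)]
  have := hsum K
  linarith [h0 M]

/-! ### Normalised moments near the critical index and uniformity in `n`. -/

/-- The inner moment, normalised to be close to `1` near the critical index. -/
noncomputable def innerScaled (b α r₁ r₂ : ℝ) (n : ℕ) (j : ℝ) : ℝ :=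
  sigma₁ b r₁ r₂ * n * innerLaplace b (n * r₁ ^ (2 * b)) (j + α)

/-- The outer moment, normalised to be close to `1` near the critical index. -/
noncomputable def outerScaled (b α r₁ r₂ : ℝ) (n : ℕ) (j : ℝ) : ℝ :=
  sigma₂ b r₁ r₂ * n * outerLaplace b (n * r₂ ^ (2 * b)) (j + α)

lemma exists_near_const {σ E : ℝ} (hσ : 0 < σ) (hE : 0 ≤ E) {y n : ℝ} (hn : 0 < n) :
    (2 / σ * |y| + 8 * E / σ ^ 2) / n ≤ (2 / σ + 8 * E / σ ^ 2) * (1 + |y|) / n := by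
  gcongr
  have h1 : 0 ≤ 2 / σ := by positivity
  have h2 : 0 ≤ 8 * E / σ ^ 2 * |y| := by positivity
  nlinarith

/-- The rate is `p - bR = nσ₁ + (j - j⋆)`; the window keeps it above `nσ₁/2`. -/
lemma innerScaled_near {b α r₁ r₂ : ℝ} (hb : 0 < b) (hr₁ : 0 < r₁) (hr₁₂ : r₁ < r₂) :
    ∃ C : ℝ, 0 ≤ C ∧ ∀ n : ℕ, 1 ≤ n → ∀ j : ℝ,
      |j - jStar b α r₁ r₂ n| ≤ n * sigma₁ b r₁ r₂ / 2 →
      |innerScaled b α r₁ r₂ n j - 1| ≤ C * (1 + |j - jStar b α r₁ r₂ n|) / n := by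
  have hs := (sigma_pos hb hr₁ hr₁₂).1
  set E := r₁ ^ (2 * b) * b ^ 2 with hE
  have hE0 : 0 ≤ E := by positivity
  refine ⟨2 / sigma₁ b r₁ r₂ + 8 * E / sigma₁ b r₁ r₂ ^ 2, by positivity, fun n hn j hj => ?_⟩
  have hn0 : (0 : ℝ) < n := by exact_mod_cast hn
  have hR : 0 ≤ n * r₁ ^ (2 * b) := by positivity
  have hm : j + α - b * (n * r₁ ^ (2 * b)) = n * sigma₁ b r₁ r₂ + (j - jStar b α r₁ r₂ n) := by
    rw [jStar, sigma₁]; ring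
  have hm' : n * sigma₁ b r₁ r₂ / 2 ≤ j + α - b * (n * r₁ ^ (2 * b)) := by
    rw [hm]; linarith [(abs_le.1 hj).1]
  have hmpos : b * (n * r₁ ^ (2 * b)) < j + α := by
    have : 0 < n * sigma₁ b r₁ r₂ := by positivity
    linarith
  refine (abs_mul_sub_one_le (E := E) hs hn0 hm' (by rw [hm, add_sub_cancel_left]) hE0 ?_
    (innerLaplace_le hb hR hmpos)).trans (exists_near_const hs hE0 hn0)
  have := innerLaplace_ge hb hR hmpos
  rwa [mul_assoc (n : ℝ), ← hE] at this

/-- The rate is `bR - p = nσ₂ - (j - j⋆)`. Large `n` is needed only for the size condition in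
`outerLaplace_ge`. -/
lemma outerScaled_near {b α r₁ r₂ : ℝ} (hb : 0 < b) (hr₁ : 0 < r₁) (hr₁₂ : r₁ < r₂) :
    ∃ C : ℝ, 0 ≤ C ∧ ∀ᶠ n : ℕ in atTop, ∀ j : ℝ,
      |j - jStar b α r₁ r₂ n| ≤ n * sigma₂ b r₁ r₂ / 2 →
      |outerScaled b α r₁ r₂ n j - 1| ≤ C * (1 + |j - jStar b α r₁ r₂ n|) / n := by
  have hs := (sigma_pos hb hr₁ hr₁₂).2
  have hr₂ : 0 < r₂ := hr₁.trans hr₁₂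
  set F := r₂ ^ (2 * b) * (b ^ 2 * Real.exp b) with hF
  have hF0 : 0 < F := by positivity
  refine ⟨2 / sigma₂ b r₁ r₂ + 8 * (2 * F) / sigma₂ b r₁ r₂ ^ 2, by positivity, ?_⟩
  filter_upwards [eventually_ge_atTop 1,
    tendsto_natCast_atTop_atTop.eventually_ge_atTop (1 / F)] with n hn hnF j hj
  have hn0 : (0 : ℝ) < n := by exact_mod_cast hn
  have hR : 0 < n * r₂ ^ (2 * b) := by positivity
  have hR1 : 1 ≤ n * r₂ ^ (2 * b) * (b ^ 2 * Real.exp b) := by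
    rw [mul_assoc, ← hF]; rwa [div_le_iff₀ hF0] at hnF
  have hm : b * (n * r₂ ^ (2 * b)) - (j + α) = n * sigma₂ b r₁ r₂ - (j - jStar b α r₁ r₂ n) := by
    rw [jStar, sigma₂]; ring
  have hm' : n * sigma₂ b r₁ r₂ / 2 ≤ b * (n * r₂ ^ (2 * b)) - (j + α) := by
    rw [hm]; linarith [(abs_le.1 hj).2]
  have hmpos : j + α < b * (n * r₂ ^ (2 * b)) := by
    have : 0 < n * sigma₂ b r₁ r₂ := by positivity
    linarith
  refine (abs_mul_sub_one_le (E := 2 * F) hs hn0 hm'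
    (Y := |j - jStar b α r₁ r₂ n|) ?_ (by positivity) ?_
    (outerLaplace_le hb hR hmpos)).trans (exists_near_const hs (by positivity) hn0)
  · rw [hm, sub_sub_cancel_left, abs_neg]
  · have h := outerLaplace_ge hb hR1 hmpos
    rwa [show 2 * (n * r₂ ^ (2 * b)) * (b ^ 2 * Real.exp b) = n * (2 * F) by rw [hF]; ring] at h

lemma floor_facts {b α r₁ r₂ : ℝ} {n : ℕ} (h : 0 ≤ jStar b α r₁ r₂ n) :
    ((⌊jStar b α r₁ r₂ n⌋₊ : ℕ) : ℤ) = ⌊jStar b α r₁ r₂ n⌋ ∧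
    (⌊jStar b α r₁ r₂ n⌋₊ : ℝ) = jStar b α r₁ r₂ n - xFrac b α r₁ r₂ n ∧
    0 ≤ xFrac b α r₁ r₂ n ∧ xFrac b α r₁ r₂ n < 1 := by
  have h1 : ((⌊jStar b α r₁ r₂ n⌋₊ : ℕ) : ℤ) = ⌊jStar b α r₁ r₂ n⌋ := Int.natCast_floor_eq_floor h
  have h2 : (⌊jStar b α r₁ r₂ n⌋₊ : ℝ) = (⌊jStar b α r₁ r₂ n⌋ : ℤ) := by exact_mod_cast h1
  refine ⟨h1, ?_, ?_, ?_⟩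
  · rw [h2, xFrac]; ring
  · rw [xFrac]; linarith [Int.floor_le (jStar b α r₁ r₂ n)]
  · rw [xFrac]; linarith [Int.lt_floor_add_one (jStar b α r₁ r₂ n)]

lemma xFrac_mem (b α r₁ r₂ : ℝ) (n : ℕ) : 0 ≤ xFrac b α r₁ r₂ n ∧ xFrac b α r₁ r₂ n ≤ 1 := by
  rw [xFrac]
  exact ⟨by linarith [Int.floor_le (jStar b α r₁ r₂ n)],
    by linarith [Int.lt_floor_add_one (jStar b α r₁ r₂ n)]⟩

/-- `x(n)` need not converge, so constants uniform in `n` require `c` to stay in a fixed compact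
subset of `(0, ∞)`. -/
lemma ratioConst_bounds {b α r₁ r₂ : ℝ} (hb : 0 < b) (hr₁ : 0 < r₁) (hr₁₂ : r₁ < r₂) (n : ℕ) :
    sigma₁ b r₁ r₂ / sigma₂ b r₁ r₂ ≤ ratioConst b α r₁ r₂ n ∧
    ratioConst b α r₁ r₂ n ≤ sigma₁ b r₁ r₂ / sigma₂ b r₁ r₂ * (r₂ / r₁) ^ 2 := by
  obtain ⟨hs1, hs2⟩ := sigma_pos hb hr₁ hr₁₂
  obtain ⟨hx0, hx1⟩ := xFrac_mem b α r₁ r₂ n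
  have hk : 1 < r₂ / r₁ := (one_lt_div hr₁).2 hr₁₂
  have hpos : 0 < sigma₁ b r₁ r₂ / sigma₂ b r₁ r₂ := by positivity
  rw [ratioConst]
  constructor
  · exact le_mul_of_one_le_right hpos.le (Real.one_le_rpow hk.le (by linarith))
  · gcongr
    rw [← Real.rpow_natCast]
    exact Real.rpow_le_rpow_of_exponent_le hk.le (by push_cast; linarith)

lemma norm_regSum_le {b α r₁ r₂ : ℝ} (hb : 0 < b) (hr₁ : 0 < r₁) (hr₁₂ : r₁ < r₂) {ζ : ℂ}
    (hζ : ‖ζ‖ = 1) : ∃ B : ℝ, 0 ≤ B ∧ ∀ n : ℕ, ‖regSum b α r₁ r₂ n ζ‖ ≤ B := by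
  obtain ⟨hs1, hs2⟩ := sigma_pos hb hr₁ hr₁₂
  set c₀ := sigma₁ b r₁ r₂ / sigma₂ b r₁ r₂ with hc₀
  have hc₀pos : 0 < c₀ := by positivity
  set κ := (r₂ / r₁) ^ 2 with hκdef
  have hκ : 1 < κ := one_lt_pow₀ ((one_lt_div hr₁).2 hr₁₂) (by norm_num)
  have hκ0 : 0 < κ := by linarith
  have hκi : κ⁻¹ < 1 := inv_lt_one_of_one_lt₀ hκ
  have key : ∀ n : ℕ, ‖regSum b α r₁ r₂ n ζ‖ ≤ ‖1 / (ζ - 1)‖ + ∑' l : ℕ, c₀⁻¹ * κ⁻¹ ^ l +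
      ∑' k : ℕ, c₀ * κ * κ⁻¹ ^ (k + 1) := by
    intro n
    obtain ⟨h1, h2⟩ := ratioConst_bounds (α := α) hb hr₁ hr₁₂ n
    rw [← hc₀] at h1 h2
    rw [← hκdef] at h2
    have hc : 0 < ratioConst b α r₁ r₂ n := hc₀pos.trans_le h1
    rw [regSum, ← hκdef]
    refine (norm_sub_le _ _).trans (add_le_add ((norm_add_le _ _).trans (add_le_add le_rfl ?_)) ?_)
    · refine tsum_of_norm_bounded
        (summable_const_mul_geometric (C := c₀⁻¹) (by positivity) hκi).hasSum fun l => ?_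
      refine (norm_positiveTail_term hc hκ ζ l).trans ?_
      rw [hζ, one_div]
      gcongr
    · refine tsum_of_norm_bounded
        (summable_const_mul_geometric_succ (C := c₀ * κ) (by positivity) hκi).hasSum fun l => ?_
      refine (norm_negativeTail_term hc hκ hζ.ge l).trans ?_
      gcongr
  exact ⟨_, (norm_nonneg _).trans (key 0), key⟩

/-- `q` is the radial damping of `z w̄ / r₁²`. It is within `O(1/n)` of `1`, and even its `n`-th
power is bounded below. -/
lemma damping_facts {T q : ℝ} {n : ℕ} (hn : 1 ≤ n) (hq : Real.exp (-(T / n)) ≤ q) (hq1 : q ≤ 1) :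
    0 < q ∧ 1 - q ≤ T / n ∧ ∀ k : ℕ, k ≤ n → q⁻¹ ^ k ≤ Real.exp T := by
  have hn0 : (0 : ℝ) < n := by exact_mod_cast hn
  have hq0 : 0 < q := (Real.exp_pos _).trans_le hq
  refine ⟨hq0, ?_, fun k hk => ?_⟩
  · linarith [Real.add_one_le_exp (-(T / n))]
  · have h1 : 1 ≤ q⁻¹ := one_le_inv_iff₀.2 ⟨hq0, hq1⟩
    have h2 : q⁻¹ ≤ Real.exp (T / n) := by
      rw [inv_le_comm₀ hq0 (Real.exp_pos _), ← Real.exp_neg]; exact hq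
    calc q⁻¹ ^ k ≤ q⁻¹ ^ n := pow_le_pow_right₀ h1 hk
      _ ≤ Real.exp (T / n) ^ n := by gcongr
      _ = Real.exp T := by rw [← Real.exp_nat_mul]; congr 1; field_simp

lemma tendsto_jStar {b α r₁ r₂ : ℝ} (hb : 0 < b) (hr₁ : 0 < r₁) (hr₁₂ : r₁ < r₂) :
    Tendsto (jStar b α r₁ r₂) atTop atTop := by
  have := tendsto_natCast_atTop_atTop (R := ℝ)
  exact tendsto_atTop_add_const_right _ (-α)
    (this.atTop_mul_const (sigmaStar_pos hr₁ hr₁₂ hb))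

/-! ### The sum over all degrees. -/

/-- The oscillatory sum of the reciprocal inner moments up to the critical index. -/
lemma geometric_part {b α r₁ r₂ : ℝ} (hb : 0 < b) (hα : -1 < α) (hr₁ : 0 < r₁) (hr₁₂ : r₁ < r₂)
    {ζ : ℂ} (hζ : ‖ζ‖ = 1) (hζ1 : ζ ≠ 1) (T : ℝ) :
    ∃ C : ℝ, ∀ᶠ n : ℕ in atTop, ∀ q : ℝ, Real.exp (-(T / n)) ≤ q → q ≤ 1 →
      ‖∑ i ∈ Finset.range ⌊jStar b α r₁ r₂ n⌋₊,
          (q * ζ) ^ i * ((1 / innerScaled b α r₁ r₂ n (i + 1) : ℝ) : ℂ)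
        - (q * ζ) ^ ⌊jStar b α r₁ r₂ n⌋₊ * (1 / (ζ - 1))‖ ≤ C / n := by
  have hs := (sigma_pos hb hr₁ hr₁₂).1
  have hss := sigmaStar_pos hr₁ hr₁₂ hb
  obtain ⟨Cg, hCg0, hCg⟩ := innerScaled_near (α := α) hb hr₁ hr₁₂
  set d := ‖ζ - 1‖ with hd
  have hdpos : 0 < d := norm_pos_iff.2 (sub_ne_zero.2 hζ1)
  set B₁ := (1 + α) + 2 * (sigmaStar b r₁ r₂ + 2) / (d / 2) with hB₁
  refine ⟨B₁ / (sigma₁ b r₁ r₂ * (d / 2)) + 4 * Cg / (d / 2) + T / (d / 2 * d), ?_⟩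
  filter_upwards [eventually_ge_atTop 1, (tendsto_jStar (α := α) hb hr₁ hr₁₂).eventually_ge_atTop 0,
    tendsto_natCast_atTop_atTop.eventually_ge_atTop (2 / sigma₁ b r₁ r₂),
    tendsto_natCast_atTop_atTop.eventually_ge_atTop (4 * Cg),
    tendsto_natCast_atTop_atTop.eventually_ge_atTop (T / (d / 2))] with n hn hj hns hnC hnT q hq hq1
  have hn1 : (1 : ℝ) ≤ n := by exact_mod_cast hn
  have hn0 : (0 : ℝ) < n := by linarith
  obtain ⟨hq0, hqT, -⟩ := damping_facts hn hq hq1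
  obtain ⟨-, hN, hx0, hx1⟩ := floor_facts hj
  set N := ⌊jStar b α r₁ r₂ n⌋₊ with hNdef
  have hT0 : 0 ≤ T := by
    have : 0 ≤ T / n := by linarith
    by_contra h
    have := div_neg_of_neg_of_pos (not_le.1 h) hn0
    linarith
  set R := (n : ℝ) * r₁ ^ (2 * b) with hR
  have hR0 : 0 ≤ R := by positivity
  set ω : ℂ := q * ζ with hω
  have hωnorm : ‖ω‖ = q := by
    rw [hω, norm_mul, hζ, mul_one, Complex.norm_real, Real.norm_of_nonneg hq0.le]
  have hωζ : ‖ζ - ω‖ ≤ T / n := by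
    have : ζ - ω = ((1 - q : ℝ) : ℂ) * ζ := by rw [hω]; push_cast; ring
    rw [this, norm_mul, hζ, mul_one, Complex.norm_real, Real.norm_of_nonneg (by linarith)]
    exact hqT
  have hωd : d / 2 ≤ ‖ω - 1‖ := by
    have h1 : T / n ≤ d / 2 := by
      rw [div_le_iff₀ hn0]
      rw [div_le_iff₀ (by positivity)] at hnT
      linarith
    have h2 : d ≤ ‖ζ - ω‖ + ‖ω - 1‖ := by
      rw [hd, show ζ - 1 = (ζ - ω) + (ω - 1) by ring]; exact norm_add_le _ _
    linarith
  have hω1pos : 0 < ‖ω - 1‖ := by linarith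
  have hω1 : ω - 1 ≠ 0 := norm_pos_iff.1 hω1pos
  have hζ1' : ζ - 1 ≠ 0 := sub_ne_zero.2 hζ1
  set β : ℕ → ℝ := fun i => 1 / innerLaplace b R ((i : ℝ) + 1 + α) with hβ
  have hp : ∀ i : ℕ, 0 < (i : ℝ) + 1 + α := fun i => by
    have : (0 : ℝ) ≤ i := Nat.cast_nonneg i
    linarith
  have hGpos : ∀ i : ℕ, 0 < innerLaplace b R ((i : ℝ) + 1 + α) := fun i =>
    innerLaplace_pos hb hR0 (hp i)
  have hβ0 : ∀ i, 0 ≤ β i := fun i => (one_div_pos.2 (hGpos i)).le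
  have hβle : ∀ i : ℕ, β i ≤ (i : ℝ) + 1 + α := fun i => by
    have := one_div_le_innerLaplace hb hR0 (hp i)
    exact (one_div_le (hp i) (hGpos i)).1 this
  have hβmono : ∀ i, β i ≤ β (i + 1) := fun i => by
    refine one_div_le_one_div_of_le (hGpos (i + 1)) (innerLaplace_anti hR0 (hp i) ?_)
    push_cast; linarith
  have hβconv : ∀ i, 2 * β (i + 1) ≤ β i + β (i + 2) := fun i => by
    have h := inv_innerLaplace_convex hb hR0 (hp i)
    have e1 : ((i + 1 : ℕ) : ℝ) + 1 + α = (i : ℝ) + 1 + α + 1 := by push_cast; ring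
    have e2 : ((i + 2 : ℕ) : ℝ) + 1 + α = (i : ℝ) + 1 + α + 2 := by push_cast; ring
    simp only [hβ]
    rw [e1, e2, mul_one_div]
    exact h
  -- Averaging over `n` further steps: `β (N+n) ≤ N + n + 1 + α ≤ n(σ⋆ + 2)`. The sequence `β` is
  -- defined past the range of the kernel sum, so `N + n > n` is harmless.
  have hinc : β (N + 1) - β N ≤ sigmaStar b r₁ r₂ + 2 := by
    refine (increment_le_of_convex hβ0 hβconv N (K := n) hn).trans ?_
    rw [div_le_iff₀ hn0]
    refine (hβle _).trans ?_
    push_cast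
    rw [hN, jStar]
    nlinarith
  have hab := norm_abel_sum_le (z := ω) (by rw [hωnorm]; exact hq1) (sub_ne_zero.1 hω1) (hβ0 0)
    hβmono hβconv N
  have hab' : ‖(ω - 1) * ∑ i ∈ Finset.range N, ω ^ i * (β i : ℂ) - ω ^ N * (β N : ℂ)‖ ≤ B₁ := by
    refine hab.trans ?_
    rw [hB₁]
    have h0 := hβle 0
    push_cast at h0
    rw [zero_add] at h0
    gcongr
  set S := ∑ i ∈ Finset.range N, ω ^ i * (β i : ℂ) with hS
  have hsn : 0 < sigma₁ b r₁ r₂ * n := by positivity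
  have hsum : ∑ i ∈ Finset.range N, ω ^ i * ((1 / innerScaled b α r₁ r₂ n (i + 1) : ℝ) : ℂ) =
      S / ((sigma₁ b r₁ r₂ * n : ℝ) : ℂ) := by
    rw [hS, Finset.sum_div]
    refine Finset.sum_congr rfl fun i _ => ?_
    rw [innerScaled, ← hR, mul_div_assoc, ← Complex.ofReal_div]
    congr 2
    simp only [hβ]
    rw [div_div, mul_comm (innerLaplace b R _)]
  -- The boundary weight `β N` belongs to degree `j = N + 1`, at distance at most `1` from `j⋆`,
  -- hence is nearly `1` after normalisation.
  set g := innerScaled b α r₁ r₂ n (N + 1) with hg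
  have hgβ : β N / (sigma₁ b r₁ r₂ * n) = 1 / g := by
    rw [hg, innerScaled, ← hR]
    simp only [hβ]
    rw [div_div, mul_comm (innerLaplace b R _)]
  have hgnear : |g - 1| ≤ 2 * Cg / n := by
    have hy : |(N : ℝ) + 1 - jStar b α r₁ r₂ n| ≤ 1 := by
      rw [hN, abs_le]; constructor <;> linarith
    have h1 : (1 : ℝ) ≤ n * sigma₁ b r₁ r₂ / 2 := by
      rw [div_le_iff₀ hs] at hns; linarith
    refine (hCg n hn _ (hy.trans h1)).trans ?_
    rw [mul_comm 2 Cg]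
    gcongr
    linarith
  have hghalf : 1 / 2 ≤ g := by
    have : 2 * Cg / n ≤ 1 / 2 := by
      rw [div_le_iff₀ hn0]; linarith
    linarith [(abs_le.1 hgnear).1]
  have hginv : |1 / g - 1| ≤ 4 * Cg / n := by
    have hg0 : 0 < g := by linarith
    have : 1 / g - 1 = -(g - 1) / g := by field_simp; ring
    rw [this, abs_div, abs_neg, abs_of_pos hg0]
    calc |g - 1| / g ≤ (2 * Cg / n) / (1 / 2) := by gcongr
      _ = _ := by ring
  have hsnc : ((sigma₁ b r₁ r₂ * n : ℝ) : ℂ) ≠ 0 := by exact_mod_cast hsn.ne'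
  rw [hsum]
  have hgβc : (β N : ℂ) / ((sigma₁ b r₁ r₂ * n : ℝ) : ℂ) = ((1 / g : ℝ) : ℂ) := by
    rw [← hgβ]; push_cast; rfl
  -- Three errors: the summation-by-parts remainder, the boundary weight against `1`, and `1/(ω-1)`
  -- against `1/(ζ-1)`.
  have e : S / ((sigma₁ b r₁ r₂ * n : ℝ) : ℂ) - ω ^ N * (1 / (ζ - 1)) =
      ((ω - 1) * S - ω ^ N * (β N : ℂ)) / (((sigma₁ b r₁ r₂ * n : ℝ) : ℂ) * (ω - 1))
      + ω ^ N * (((1 / g - 1 : ℝ) : ℂ) / (ω - 1))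
      + ω ^ N * ((ζ - ω) / ((ω - 1) * (ζ - 1))) := by
    rw [Complex.ofReal_sub, ← hgβc]
    push_cast at hsnc ⊢
    field_simp
    ring
  rw [e]
  have hωN : ‖ω ^ N‖ ≤ 1 := by
    rw [norm_pow, hωnorm]; exact pow_le_one₀ hq0.le hq1
  have t1 : ‖((ω - 1) * S - ω ^ N * (β N : ℂ)) / (((sigma₁ b r₁ r₂ * n : ℝ) : ℂ) * (ω - 1))‖ ≤
      B₁ / (sigma₁ b r₁ r₂ * n * (d / 2)) := by
    rw [norm_div, norm_mul, Complex.norm_real, Real.norm_of_nonneg hsn.le]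
    have := (norm_nonneg _).trans hab'
    gcongr
  have t2 : ‖ω ^ N * (((1 / g - 1 : ℝ) : ℂ) / (ω - 1))‖ ≤ (4 * Cg / n) / (d / 2) := by
    rw [norm_mul, norm_div, Complex.norm_real, Real.norm_eq_abs]
    refine (mul_le_of_le_one_left (by positivity) hωN).trans ?_
    gcongr
  have t3 : ‖ω ^ N * ((ζ - ω) / ((ω - 1) * (ζ - 1)))‖ ≤ (T / n) / (d / 2 * d) := by
    rw [norm_mul, norm_div, norm_mul, ← hd]
    refine (mul_le_of_le_one_left (by positivity) hωN).trans ?_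
    gcongr
  refine (norm_add₃_le.trans (add_le_add (add_le_add t1 t2) t3)).trans_eq ?_
  field_simp

/-- The ratio of the leading outer and inner contributions to the `j`-th squared norm. -/
noncomputable def momentRatio (b α r₁ r₂ : ℝ) (n : ℕ) (j : ℝ) : ℝ :=
  sigma₁ b r₁ r₂ / sigma₂ b r₁ r₂ * (r₂ / r₁) ^ (2 * (j - jStar b α r₁ r₂ n))

lemma momentRatio_above {b α r₁ r₂ : ℝ} (hr₁ : 0 < r₁) (hr₁₂ : r₁ < r₂) {n N : ℕ}
    (hN : (N : ℝ) = jStar b α r₁ r₂ n - xFrac b α r₁ r₂ n) (l : ℕ) :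
    momentRatio b α r₁ r₂ n (N + l + 1) = ratioConst b α r₁ r₂ n * ((r₂ / r₁) ^ 2) ^ l := by
  have hk : 0 < r₂ / r₁ := div_pos (hr₁.trans hr₁₂) hr₁
  rw [momentRatio, ratioConst, mul_assoc, ← pow_mul, ← Real.rpow_natCast (r₂ / r₁),
    ← Real.rpow_add hk, hN]
  congr 2; push_cast; ring

lemma momentRatio_below {b α r₁ r₂ : ℝ} (hr₁ : 0 < r₁) (hr₁₂ : r₁ < r₂) {n N : ℕ}
    (hN : (N : ℝ) = jStar b α r₁ r₂ n - xFrac b α r₁ r₂ n) (k : ℕ) :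
    momentRatio b α r₁ r₂ n (N - k) = ratioConst b α r₁ r₂ n * ((r₂ / r₁) ^ 2)⁻¹ ^ (k + 1) := by
  have hk : 0 < r₂ / r₁ := div_pos (hr₁.trans hr₁₂) hr₁
  rw [momentRatio, ratioConst, mul_assoc, inv_pow, ← pow_mul, ← Real.rpow_natCast (r₂ / r₁),
    ← Real.rpow_neg hk.le, ← Real.rpow_add hk, hN]
  congr 2; push_cast; ring

set_option maxHeartbeats 1000000 in
/-- The normalised kernel sum, compared with the regularised bilateral series. -/
lemma scaled_sum_asymp {b α r₁ r₂ : ℝ} (hb : 0 < b) (hα : -1 < α) (hr₁ : 0 < r₁)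
    (hr₁₂ : r₁ < r₂) (hr₂ : r₂ < b ^ (-(1 / (2 * b)))) {ζ : ℂ} (hζ : ‖ζ‖ = 1) (hζ1 : ζ ≠ 1)
    {T : ℝ} (hT : 0 ≤ T) :
    ∃ C : ℝ, ∀ᶠ n : ℕ in atTop, ∀ q : ℝ, Real.exp (-(T / n)) ≤ q → q ≤ 1 →
      ‖∑ i ∈ Finset.range n, (q * ζ) ^ i /
          ((innerScaled b α r₁ r₂ n (i + 1) + momentRatio b α r₁ r₂ n (i + 1) *
            outerScaled b α r₁ r₂ n (i + 1) : ℝ) : ℂ)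
        - (q * ζ) ^ ⌊jStar b α r₁ r₂ n⌋₊ * regSum b α r₁ r₂ n ζ‖ ≤ C / n := by
  obtain ⟨hs1, hs2⟩ := sigma_pos hb hr₁ hr₁₂
  have hss := sigmaStar_pos hr₁ hr₁₂ hb
  have hss1 := sigmaStar_lt_one hb hr₁ hr₁₂ hr₂
  have hr₂0 : 0 < r₂ := hr₁.trans hr₁₂
  obtain ⟨C₁, hC₁, hin⟩ := innerScaled_near (α := α) hb hr₁ hr₁₂
  obtain ⟨C₂, hC₂, hout⟩ := outerScaled_near (α := α) hb hr₁ hr₁₂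
  obtain ⟨C₃, hgeo⟩ := geometric_part (α := α) hb hα hr₁ hr₁₂ hζ hζ1 T
  set s₁ := sigma₁ b r₁ r₂ with hs₁def
  set s₂ := sigma₂ b r₁ r₂ with hs₂def
  set ss := sigmaStar b r₁ r₂ with hssdef
  set κ := (r₂ / r₁) ^ 2 with hκdef
  have hκ : 1 < κ := one_lt_pow₀ ((one_lt_div hr₁).2 hr₁₂) (by norm_num)
  set c₀ := s₁ / s₂ with hc₀
  have hc₀pos : 0 < c₀ := by positivity
  -- The `2` absorbs `1 + |j - j⋆| ≤ 2(1 + k)`; the `T` covers `1 - q ≤ T/n`.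
  set C := 2 * (C₁ + C₂) + T with hC
  have hC0 : 0 ≤ C := by positivity
  -- The window `k ≤ δn` must lie where both Laplace estimates hold, fit inside `[1, n]` on both
  -- sides of `j⋆`, and keep the relative errors at most `1/2`.
  obtain ⟨δ, hδ, hδ1, hδ2, hδ3, hδ4, hδ5⟩ : ∃ δ : ℝ, 0 < δ ∧ δ ≤ s₁ / 4 ∧ δ ≤ s₂ / 4 ∧
      δ ≤ (1 - ss) / 2 ∧ δ ≤ ss / 2 ∧ δ ≤ 1 / (4 * (C + 1)) := by
    refine ⟨min (s₁ / 4) (min (s₂ / 4) (min ((1 - ss) / 2) (min (ss / 2) (1 / (4 * (C + 1)))))),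
      ?_, ?_, ?_, ?_, ?_, ?_⟩
    · have : 0 < (1 - ss) / 2 := by linarith
      exact lt_min (by positivity) (lt_min (by positivity) (lt_min this
        (lt_min (by positivity) (by positivity))))
    · exact min_le_left _ _
    · exact (min_le_right _ _).trans (min_le_left _ _)
    · exact (min_le_right _ _).trans ((min_le_right _ _).trans (min_le_left _ _))
    · exact (min_le_right _ _).trans ((min_le_right _ _).trans ((min_le_right _ _).trans
        (min_le_left _ _)))
    · exact (min_le_right _ _).trans ((min_le_right _ _).trans ((min_le_right _ _).trans
        (min_le_right _ _)))
  set W := ∑' l : ℕ, (1 + (l : ℝ)) * κ⁻¹ ^ l with hW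
  set Q := Real.exp T with hQ
  refine ⟨C₃ + ((8 * Q * C + 16 * C + (Q * 1 / (s₁ / ss) ^ 2 + 1) / δ) * (c₀ * κ)) * W +
    ((4 * C + 3 / δ) / c₀) * W, ?_⟩
  have hcast := tendsto_natCast_atTop_atTop (R := ℝ)
  filter_upwards [eventually_ge_atTop 1, (tendsto_jStar (α := α) hb hr₁ hr₁₂).eventually_ge_atTop 0,
    hcast.eventually_ge_atTop (4 / s₁), hcast.eventually_ge_atTop (4 / s₂),
    hcast.eventually_ge_atTop (4 / (1 - ss)), hcast.eventually_ge_atTop (2 * (α + 1) / ss),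
    hcast.eventually_ge_atTop (4 * C), hout, hgeo] with n hn hj hn1 hn2 hn3 hn4 hnC hout hgeo q hq hq1
  have hn0 : (0 : ℝ) < n := by exact_mod_cast hn
  rw [div_le_iff₀ hs1] at hn1
  rw [div_le_iff₀ hs2] at hn2
  rw [div_le_iff₀ (by linarith)] at hn3
  rw [div_le_iff₀ hss] at hn4
  obtain ⟨hq0, hqT, hqQ⟩ := damping_facts hn hq hq1
  obtain ⟨-, hN, hx0, hx1⟩ := floor_facts hj
  have hgeo := hgeo q hq hq1
  set N := ⌊jStar b α r₁ r₂ n⌋₊ with hNdef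
  set x := xFrac b α r₁ r₂ n with hxdef
  have hjS : jStar b α r₁ r₂ n = n * ss - α := rfl
  obtain ⟨hca, hcb⟩ := ratioConst_bounds (α := α) hb hr₁ hr₁₂ n
  set c := ratioConst b α r₁ r₂ n with hcdef
  have hcpos : 0 < c := hc₀pos.trans_le hca
  have hδn1 : δ * n ≤ n * s₁ / 4 := by
    linarith [mul_le_mul_of_nonneg_right hδ1 hn0.le]
  have hδn2 : δ * n ≤ n * s₂ / 4 := by
    linarith [mul_le_mul_of_nonneg_right hδ2 hn0.le]
  have hδn3 : δ * n ≤ (n - n * ss) / 2 := by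
    linarith [mul_le_mul_of_nonneg_right hδ3 hn0.le]
  have hδn4 : δ * n ≤ n * ss / 2 := by
    linarith [mul_le_mul_of_nonneg_right hδ4 hn0.le]
  have hδn5 : C * (δ * n) ≤ n / 4 := by
    have : C * δ ≤ 1 / 4 := by
      rw [le_div_iff₀ (by positivity)] at hδ5
      linarith
    linarith [mul_le_mul_of_nonneg_right this hn0.le]
  have hNn : N ≤ n := by
    have : (N : ℝ) ≤ n := by rw [hN, hjS]; linarith
    exact_mod_cast this
  have hqC : 1 - q ≤ C / n := hqT.trans (by gcongr; linarith)
  have hR₁ : 0 ≤ (n : ℝ) * r₁ ^ (2 * b) := by positivity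
  have hR₂ : 0 < (n : ℝ) * r₂ ^ (2 * b) := by positivity
  -- closeness to one around the critical index
  have hnear : ∀ (k : ℕ) (j : ℝ), (k : ℝ) ≤ δ * n → |j - jStar b α r₁ r₂ n| ≤ 1 + k →
      |innerScaled b α r₁ r₂ n j - 1| ≤ C * (1 + k) / n ∧
      |outerScaled b α r₁ r₂ n j - 1| ≤ C * (1 + k) / n := by
    intro k j hk hjk
    have hk0 : (0 : ℝ) ≤ k := Nat.cast_nonneg k
    have h1 := hin n hn j (hjk.trans (by linarith))
    have h2 := hout j (hjk.trans (by linarith))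
    have h3 : 1 + |j - jStar b α r₁ r₂ n| ≤ 2 * (1 + k) := by linarith
    constructor
    · refine h1.trans ?_
      refine div_le_div_of_nonneg_right ?_ hn0.le
      calc C₁ * (1 + |j - jStar b α r₁ r₂ n|) ≤ C₁ * (2 * (1 + k)) := by gcongr
        _ = 2 * C₁ * (1 + k) := by ring
        _ ≤ C * (1 + k) := by gcongr; linarith
    · refine h2.trans ?_
      refine div_le_div_of_nonneg_right ?_ hn0.le
      calc C₂ * (1 + |j - jStar b α r₁ r₂ n|) ≤ C₂ * (2 * (1 + k)) := by gcongr
        _ = 2 * C₂ * (1 + k) := by ring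
        _ ≤ C * (1 + k) := by gcongr; linarith
  have hhalf : ∀ k : ℕ, (k : ℝ) ≤ δ * n → C * (1 + k) / n ≤ 1 / 2 := by
    intro k hk
    rw [div_le_iff₀ hn0]
    have : C * k ≤ C * (δ * n) := by gcongr
    linarith
  have hup : ∀ l : ℕ, |(N : ℝ) + l + 1 - jStar b α r₁ r₂ n| ≤ 1 + l := by
    intro l
    have hl0 : (0 : ℝ) ≤ l := Nat.cast_nonneg l
    rw [hN, abs_le]; constructor <;> linarith
  have hlow : ∀ k : ℕ, |(N : ℝ) - k - jStar b α r₁ r₂ n| ≤ 1 + k := by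
    intro l
    have hl0 : (0 : ℝ) ≤ l := Nat.cast_nonneg l
    rw [hN, abs_le]; constructor <;> linarith
  -- the part above the critical index
  have hU := upper_sum_le (g := fun l => innerScaled b α r₁ r₂ n (N + l + 1))
    (lam := fun l => outerScaled b α r₁ r₂ n (N + l + 1)) (M := n - N) (c := c) (ζ := ζ) (q := q)
    hκ hc₀pos hca hC0 hδ hn0 hζ hq0.le hq1 hqC
    (fun l _ => by
      rw [innerScaled]
      have : 0 < innerLaplace b (n * r₁ ^ (2 * b)) ((N : ℝ) + l + 1 + α) :=
        innerLaplace_pos hb hR₁ (by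
          have : (0 : ℝ) ≤ N := Nat.cast_nonneg N
          have : (0 : ℝ) ≤ l := Nat.cast_nonneg l
          linarith)
      positivity)
    -- Monotonicity in `p` carries the lower bound at `l = 0` to all larger `l`, including those
    -- with `p ≥ bR`, where the rate estimates fail.
    (fun l _ => by
      have h0 := (hnear 0 (N + (0 : ℕ) + 1) (by simpa using by positivity) (hup 0)).2
      have h1 := hhalf 0 (by simpa using by positivity)
      have h2 : outerScaled b α r₁ r₂ n (N + (0 : ℕ) + 1) ≤ outerScaled b α r₁ r₂ n (N + l + 1) := by
        rw [outerScaled, outerScaled]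
        have : outerLaplace b (n * r₂ ^ (2 * b)) ((N : ℝ) + (0 : ℕ) + 1 + α) ≤
            outerLaplace b (n * r₂ ^ (2 * b)) ((N : ℝ) + l + 1 + α) :=
          outerLaplace_mono hb hR₂ (by
            have : (0 : ℝ) ≤ l := Nat.cast_nonneg l
            push_cast; linarith)
        gcongr
      refine le_trans ?_ h2
      have h3 := (abs_le.1 (h0.trans h1)).1
      generalize outerScaled b α r₁ r₂ n (N + (0 : ℕ) + 1) = v at h3 ⊢
      linarith)
    (fun l hl => by
      have : (l : ℝ) + N < n := by rw [hN, hjS]; linarith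
      have : l + N < n := by exact_mod_cast this
      omega)
    (fun l hl => (hnear l _ hl (hup l)).1) (fun l hl => (hnear l _ hl (hup l)).2)
  -- the correction below the critical index
  have hpk : ∀ k < N, 0 < (N : ℝ) - k + α ∧ (N : ℝ) - k + α ≤ n * ss := by
    intro k hk
    have h1 : (k : ℝ) + 1 ≤ N := by exact_mod_cast hk
    have h2 : (0 : ℝ) ≤ k := Nat.cast_nonneg k
    refine ⟨by linarith, ?_⟩
    have : (N : ℝ) + α ≤ n * ss := by rw [hN, hjS]; linarith
    linarith
  -- From `1/p ≤ innerLaplace` and `p ≤ nσ⋆`: a bound uniform down to degree `1`.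
  have hgk : ∀ k < N, s₁ / ss ≤ innerScaled b α r₁ r₂ n (N - k) := by
    intro k hk
    obtain ⟨h1, h2⟩ := hpk k hk
    have h3 := one_div_le_innerLaplace hb hR₁ h1
    rw [innerScaled]
    calc s₁ / ss = s₁ * n * (1 / (n * ss)) := by field_simp
      _ ≤ s₁ * n * (1 / ((N : ℝ) - k + α)) := by gcongr
      _ ≤ _ := by gcongr
  have hlk0 : ∀ k : ℕ, 0 ≤ outerScaled b α r₁ r₂ n (N - k) := fun k => by
    rw [outerScaled]
    have := outerLaplace_nonneg (b := b) (R := n * r₂ ^ (2 * b)) (p := (N : ℝ) - k + α)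
    positivity
  have hlk : ∀ k < N, outerScaled b α r₁ r₂ n (N - k) ≤ 1 := by
    intro k hk
    obtain ⟨h1, h2⟩ := hpk k hk
    have e : b * (n * r₂ ^ (2 * b)) = n * ss + n * s₂ := by rw [hs₂def, sigma₂]; ring
    have hns : 0 < n * s₂ := by positivity
    have h3 := outerLaplace_le hb hR₂ (p := (N : ℝ) - k + α) (by linarith)
    rw [outerScaled]
    calc s₂ * n * outerLaplace b (n * r₂ ^ (2 * b)) ((N : ℝ) - k + α)
        ≤ s₂ * n * (1 / (b * (n * r₂ ^ (2 * b)) - ((N : ℝ) - k + α))) := by gcongr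
      _ ≤ s₂ * n * (1 / (n * s₂)) := by gcongr; linarith
      _ = 1 := by field_simp
  have hMlow : ∀ k : ℕ, (k : ℝ) ≤ δ * n → k < N := fun k hk => by
    have : (k : ℝ) < N := by rw [hN, hjS]; linarith
    exact_mod_cast this
  have hL := lower_sum_le (g := fun k => innerScaled b α r₁ r₂ n (N - k))
    (lam := fun k => outerScaled b α r₁ r₂ n (N - k)) (M := N) (c := c) (c₁ := c₀ * κ) (ζ := ζ)
    (q := q) (Q := Q) (g₀ := s₁ / ss) (Lam := 1)
    hκ hcpos hcb hC0 hδ hn0 hζ hq0 hq1 hqC (fun k hk => hqQ _ (by omega)) (by positivity)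
    hgk (fun k _ => hlk0 k) hlk hMlow
    (fun k hk => by
      have h1 := (hnear k _ hk (hlow k)).1
      have h2 := hhalf k hk
      exact ⟨by linarith [(abs_le.1 h1).1], by linarith [(abs_le.1 h1).2]⟩)
    (fun k hk => (hlk k (hMlow k hk)).trans (by norm_num))
    (fun k hk => (hnear k _ hk (hlow k)).1) (fun k hk => (hnear k _ hk (hlow k)).2)
  set ω : ℂ := q * ζ with hω
  have hω0 : ω ≠ 0 := by
    rw [hω]; refine mul_ne_zero (by exact_mod_cast hq0.ne') ?_
    rw [← norm_pos_iff, hζ]; exact one_pos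
  have hωN : ‖ω ^ N‖ ≤ 1 := by
    rw [norm_pow, hω, norm_mul, hζ, mul_one, Complex.norm_real, Real.norm_of_nonneg hq0.le]
    exact pow_le_one₀ hq0.le hq1
  set G := ∑ i ∈ Finset.range N, ω ^ i * ((1 / innerScaled b α r₁ r₂ n (i + 1) : ℝ) : ℂ) with hG
  set U := ∑ l ∈ Finset.range (n - N), ω ^ l / ((innerScaled b α r₁ r₂ n (N + l + 1) +
    c * κ ^ l * outerScaled b α r₁ r₂ n (N + l + 1) : ℝ) : ℂ) with hUdef
  set L := ∑ k ∈ Finset.range N, ω⁻¹ ^ (k + 1) * ((c * κ⁻¹ ^ (k + 1) *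
    outerScaled b α r₁ r₂ n (N - k) / (innerScaled b α r₁ r₂ n (N - k) *
      (innerScaled b α r₁ r₂ n (N - k) + c * κ⁻¹ ^ (k + 1) *
        outerScaled b α r₁ r₂ n (N - k))) : ℝ) : ℂ) with hLdef
  -- Below `N` this is `1/(g+v) = 1/g - v/(g(g+v))` with the reflection `k = N-1-i`; above `N` it is
  -- only a shift of index.
  have hsplit : ∑ i ∈ Finset.range n, ω ^ i /
          ((innerScaled b α r₁ r₂ n (i + 1) + momentRatio b α r₁ r₂ n (i + 1) *
            outerScaled b α r₁ r₂ n (i + 1) : ℝ) : ℂ) = G - ω ^ N * L + ω ^ N * U := by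
    have hsr : ∀ f : ℕ → ℂ, ∑ i ∈ Finset.range n, f i =
        ∑ i ∈ Finset.range N, f i + ∑ i ∈ Finset.range (n - N), f (N + i) := fun f => by
      rw [← Finset.sum_range_add, Nat.add_sub_cancel' hNn]
    rw [hsr]
    congr 1
    · have hlowsum : ω ^ N * L = ∑ i ∈ Finset.range N, ω ^ i *
          ((momentRatio b α r₁ r₂ n (i + 1) * outerScaled b α r₁ r₂ n (i + 1) /
            (innerScaled b α r₁ r₂ n (i + 1) * (innerScaled b α r₁ r₂ n (i + 1) +
              momentRatio b α r₁ r₂ n (i + 1) * outerScaled b α r₁ r₂ n (i + 1))) : ℝ) : ℂ) := by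
        rw [hLdef, Finset.mul_sum, ← Finset.sum_range_reflect]
        refine Finset.sum_congr rfl fun i hi => ?_
        have hi' : i < N := Finset.mem_range.1 hi
        have e1 : N - 1 - i + 1 = N - i := by omega
        have e2 : ((N - 1 - i : ℕ) : ℝ) = N - (i + 1) := by
          rw [Nat.sub_sub, Nat.cast_sub (by omega)]; push_cast; ring
        have e3 : (N : ℝ) - ((N - 1 - i : ℕ) : ℝ) = i + 1 := by rw [e2]; ring
        have e4 := momentRatio_below hr₁ hr₁₂ hN (N - 1 - i)
        rw [← hcdef, ← hκdef, e3] at e4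
        rw [← e4, e3, e1, ← mul_assoc]
        congr 1
        rw [inv_pow, ← div_eq_mul_inv, div_eq_iff (pow_ne_zero _ hω0), ← pow_add]
        congr 1; omega
      rw [hlowsum, hG, ← Finset.sum_sub_distrib]
      refine Finset.sum_congr rfl fun i hi => ?_
      have hi' : i < N := Finset.mem_range.1 hi
      have e3 : (N : ℝ) - ((N - 1 - i : ℕ) : ℝ) = i + 1 := by
        rw [Nat.sub_sub, Nat.cast_sub (by omega)]; push_cast; ring
      have hgi := hgk (N - 1 - i) (by omega)
      have hli := hlk0 (N - 1 - i)
      rw [e3] at hgi hli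
      have hgpos : 0 < innerScaled b α r₁ r₂ n (i + 1) := lt_of_lt_of_le (by positivity) hgi
      have hapos : 0 < momentRatio b α r₁ r₂ n (i + 1) := by rw [momentRatio]; positivity
      have hden := add_pos_of_pos_of_nonneg hgpos (mul_nonneg hapos.le hli)
      rw [← mul_sub, ← Complex.ofReal_sub, div_eq_mul_inv, ← Complex.ofReal_inv]
      congr 2
      generalize innerScaled b α r₁ r₂ n (i + 1) = g at hgpos hden ⊢
      generalize momentRatio b α r₁ r₂ n (i + 1) * outerScaled b α r₁ r₂ n (i + 1) = v at hden ⊢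
      field_simp
      ring
    · rw [hUdef, Finset.mul_sum]
      refine Finset.sum_congr rfl fun l _ => ?_
      have e := momentRatio_above hr₁ hr₁₂ hN l
      rw [← hcdef, ← hκdef] at e
      rw [← e, pow_add, mul_div_assoc]
      push_cast
      rfl
  rw [hsplit]
  have e : G - ω ^ N * L + ω ^ N * U - ω ^ N * regSum b α r₁ r₂ n ζ =
      (G - ω ^ N * (1 / (ζ - 1))) - ω ^ N * (L - negativeTail c κ ζ)
        + ω ^ N * (U - positiveTail c κ ζ) := by
    rw [regSum, ← hcdef, ← hκdef]; ring
  rw [e]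
  have t2 := ((norm_mul (ω ^ N) (L - negativeTail c κ ζ)).trans_le
    (mul_le_of_le_one_left (norm_nonneg _) hωN)).trans hL
  have t3 := ((norm_mul (ω ^ N) (U - positiveTail c κ ζ)).trans_le
    (mul_le_of_le_one_left (norm_nonneg _) hωN)).trans hU
  refine ((norm_add_le _ _).trans (add_le_add ((norm_sub_le _ _).trans
    (add_le_add hgeo t2)) t3)).trans_eq ?_
  rw [← hW]
  ring

/-! ### The radial profile near the inner circle. -/

lemma log_one_sub_bounds {τ : ℝ} (h0 : 0 ≤ τ) (h1 : τ ≤ 1 / 2) :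
    |Real.log (1 - τ) + τ| ≤ 2 * τ ^ 2 ∧ |Real.log (1 - τ)| ≤ 2 * τ := by
  have hpos : 0 < 1 - τ := by linarith
  have hup : Real.log (1 - τ) ≤ -τ := by linarith [Real.log_le_sub_one_of_pos hpos]
  have hlow : -τ - 2 * τ ^ 2 ≤ Real.log (1 - τ) := by
    have h := Real.one_sub_inv_le_log_of_pos hpos
    have h2 : (1 - τ)⁻¹ ≤ 1 + τ + 2 * τ ^ 2 := by
      rw [inv_le_iff_one_le_mul₀ hpos]
      nlinarith [sq_nonneg τ]
    linarith
  constructor <;> rw [abs_le] <;> constructor <;> nlinarith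

lemma exp_neg_two_mul_le {τ : ℝ} (h0 : 0 ≤ τ) (h1 : τ ≤ 1 / 2) : Real.exp (-(2 * τ)) ≤ 1 - τ := by
  rw [← Real.le_log_iff_exp_le (by linarith)]
  linarith [(abs_le.1 (log_one_sub_bounds h0 h1).2).1]

set_option maxHeartbeats 600000 in
lemma radialFactor_asymp {b α r₁ r₂ : ℝ} (hb : 0 < b) (hr₁ : 0 < r₁) (hr₁₂ : r₁ < r₂) {t : ℝ}
    (ht : 0 ≤ t) : ∃ C : ℝ, 0 ≤ C ∧ ∀ᶠ n : ℕ in atTop,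
      |radialFactor b α r₁ n (t / (sigma₁ b r₁ r₂ * n)) *
        (1 - t / (sigma₁ b r₁ r₂ * n)) ^ ⌊jStar b α r₁ r₂ n⌋₊ - Real.exp (-t)| ≤ C / n := by
  have hs := (sigma_pos hb hr₁ hr₁₂).1
  have hss := sigmaStar_pos hr₁ hr₁₂ hb
  set s := sigma₁ b r₁ r₂ with hsdef
  set ss := sigmaStar b r₁ r₂ with hssdef
  set R := r₁ ^ (2 * b) with hR
  have hR0 : 0 < R := by positivity
  set T := t / s with hT
  have hT0 : 0 ≤ T := by positivity
  set K := (ss + 1) * (2 * T ^ 2) + T + 8 * R * b ^ 2 * T ^ 2 + 2 * R * b * T ^ 2 with hK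
  have hK0 : 0 ≤ K := by positivity
  have hcast := tendsto_natCast_atTop_atTop (R := ℝ)
  refine ⟨2 * K, by positivity, ?_⟩
  filter_upwards [eventually_ge_atTop 1, (tendsto_jStar (α := α) hb hr₁ hr₁₂).eventually_ge_atTop 0,
    hcast.eventually_ge_atTop (2 * T), hcast.eventually_ge_atTop (4 * b * T),
    hcast.eventually_ge_atTop K] with n hn hj hnT hnb hnK
  have hn1 : (1 : ℝ) ≤ n := by exact_mod_cast hn
  have hn0 : (0 : ℝ) < n := by linarith
  obtain ⟨-, hN, hx0, hx1⟩ := floor_facts hj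
  set N := ⌊jStar b α r₁ r₂ n⌋₊ with hNdef
  set x := xFrac b α r₁ r₂ n with hxdef
  have hτdef : t / (s * n) = T / n := by rw [hT, div_div]
  rw [hτdef]
  set τ := T / n with hτ
  have hτ0 : 0 ≤ τ := by positivity
  have hτh : τ ≤ 1 / 2 := by rw [hτ, div_le_iff₀ hn0]; linarith
  have hnτ : n * τ = T := by rw [hτ]; field_simp
  obtain ⟨hl1, hl2⟩ := log_one_sub_bounds hτ0 hτh
  have hpos : 0 < 1 - τ := by linarith
  set u := Real.log (1 - τ) with hu
  have hbu : |2 * b * u| ≤ 4 * b * τ := by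
    rw [abs_mul, abs_of_pos (by positivity : 0 < 2 * b)]
    nlinarith
  have hbτ : 4 * b * τ ≤ 1 := by
    have : 4 * b * τ = 4 * b * T / n := by rw [hτ]; ring
    rw [this, div_le_one hn0]; exact hnb
  have hq := Real.abs_exp_sub_one_sub_id_le (hbu.trans hbτ)
  have hq' : (2 * b * u) ^ 2 ≤ 16 * b ^ 2 * τ ^ 2 := by
    rw [← sq_abs]
    calc |2 * b * u| ^ 2 ≤ (4 * b * τ) ^ 2 := by gcongr
      _ = _ := by ring
  -- The factor `(1-τ)^α` cancels the `-α` in `N = nσ⋆ - α - x`. To first order the exponent is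
  -- `-nσ⋆τ + nbRτ = -nσ₁τ = -t`.
  have hprod : radialFactor b α r₁ n τ * (1 - τ) ^ N =
      Real.exp ((n * ss - x) * u + n * R / 2 * (1 - Real.exp (2 * b * u))) := by
    rw [radialFactor, Real.rpow_def_of_pos hpos, Real.rpow_def_of_pos hpos, ← hR, ← hu,
      ← Real.rpow_natCast, Real.rpow_def_of_pos hpos, ← hu, ← Real.exp_add, ← Real.exp_add, hN,
      jStar, ← hssdef]
    ring_nf
  set e := (n * ss - x) * u + n * R / 2 * (1 - Real.exp (2 * b * u)) + t with he
  have hsR : s = ss - b * R := rfl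
  have htT : t = s * T := by rw [hT]; field_simp
  have hdecomp : e = (n * ss - x) * (u + τ) + x * τ
      - n * R / 2 * (Real.exp (2 * b * u) - 1 - 2 * b * u) - n * R * b * (u + τ) := by
    rw [he, htT, hsR, ← hnτ]; ring
  have hnsx : |n * ss - x| ≤ n * (ss + 1) := by
    have : 0 ≤ n * ss := by positivity
    rw [abs_le, mul_add, mul_one]; constructor <;> linarith
  have heb : |e| ≤ K / n := by
    have b1 : |(n * ss - x) * (u + τ)| ≤ n * (ss + 1) * (2 * τ ^ 2) := by
      rw [abs_mul]; gcongr
    have b2 : |x * τ| ≤ τ := by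
      rw [abs_of_nonneg (by positivity)]; nlinarith
    have b3 : |n * R / 2 * (Real.exp (2 * b * u) - 1 - 2 * b * u)| ≤
        n * R / 2 * (16 * b ^ 2 * τ ^ 2) := by
      rw [abs_mul, abs_of_pos (by positivity : 0 < n * R / 2)]
      gcongr
      exact hq.trans hq'
    have b4 : |n * R * b * (u + τ)| ≤ n * R * b * (2 * τ ^ 2) := by
      rw [abs_mul, abs_of_pos (by positivity : 0 < n * R * b)]; gcongr
    have b5 : K / n = n * (ss + 1) * (2 * τ ^ 2) + τ + n * R / 2 * (16 * b ^ 2 * τ ^ 2)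
        + n * R * b * (2 * τ ^ 2) := by
      rw [hK, hτ]; field_simp; ring
    rw [b5, hdecomp]
    rw [abs_le] at b1 b2 b3 b4 ⊢
    constructor <;> linarith [b1.1, b1.2, b2.1, b2.2, b3.1, b3.2, b4.1, b4.2]
  have he1 : |e| ≤ 1 := heb.trans ((div_le_one hn0).2 hnK)
  rw [hprod, show (n * ss - x) * u + n * R / 2 * (1 - Real.exp (2 * b * u)) = -t + e by
    rw [he]; ring, Real.exp_add]
  have hf : Real.exp (-t) * Real.exp e - Real.exp (-t) = Real.exp (-t) * (Real.exp e - 1) := by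
    ring
  rw [hf, abs_mul, abs_of_pos (Real.exp_pos _)]
  have h1 : Real.exp (-t) ≤ 1 := Real.exp_le_one_iff.2 (by linarith)
  have h2 := Real.abs_exp_sub_one_le he1
  calc Real.exp (-t) * |Real.exp e - 1| ≤ 1 * (2 * |e|) := by gcongr
    _ ≤ 1 * (2 * (K / n)) := by gcongr
    _ = 2 * K / n := by ring

/-! ### Assembling the kernel asymptotics. -/

lemma innerLaplace_add_eq {b α r₁ r₂ : ℝ} (hb : 0 < b) (hr₁ : 0 < r₁) (hr₁₂ : r₁ < r₂) {n : ℕ}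
    (hn : 1 ≤ n) (j : ℝ) :
    innerLaplace b (n * r₁ ^ (2 * b)) (j + α) +
        (r₂ / r₁) ^ (2 * (j - jStar b α r₁ r₂ n)) * outerLaplace b (n * r₂ ^ (2 * b)) (j + α) =
      (innerScaled b α r₁ r₂ n j + momentRatio b α r₁ r₂ n j * outerScaled b α r₁ r₂ n j) /
        (sigma₁ b r₁ r₂ * n) := by
  obtain ⟨hs1, hs2⟩ := sigma_pos hb hr₁ hr₁₂
  have hn0 : (0 : ℝ) < n := by exact_mod_cast hn
  rw [innerScaled, outerScaled, momentRatio]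
  field_simp

lemma one_le_sqrt_mul_log {n : ℕ} (hn : 3 ≤ n) : 1 ≤ Real.sqrt (n * Real.log n) := by
  have h3 : (3 : ℝ) ≤ n := by exact_mod_cast hn
  have hlog : 1 ≤ Real.log n := by
    rw [Real.le_log_iff_exp_le (by linarith)]
    linarith [Real.exp_one_lt_d9]
  rw [Real.one_le_sqrt]
  nlinarith

lemma eventually_le_of_jStar {b α r₁ r₂ : ℝ} (hb : 0 < b) (hr₁ : 0 < r₁) (hr₁₂ : r₁ < r₂)
    (hr₂ : r₂ < b ^ (-(1 / (2 * b)))) :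
    ∀ᶠ n : ℕ in atTop, ⌊jStar b α r₁ r₂ n⌋₊ ≤ n := by
  have hss1 := sigmaStar_lt_one hb hr₁ hr₁₂ hr₂
  have hpos : 0 < 1 - sigmaStar b r₁ r₂ := by linarith
  filter_upwards [(tendsto_natCast_atTop_atTop (R := ℝ)).eventually_ge_atTop
    (-α / (1 - sigmaStar b r₁ r₂))] with n hn
  rw [div_le_iff₀ hpos] at hn
  refine Nat.floor_le_of_le ?_
  rw [jStar]; linarith

set_option maxHeartbeats 1000000 in
/-- The kernel asymptotics on the inner edge, with a bounded error. -/
lemma kernel_sub_eventually_bounded {b α r₁ r₂ : ℝ} (hb : 0 < b) (hα : -1 < α)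
    (hr₁ : 0 < r₁) (hr₁₂ : r₁ < r₂) (hr₂ : r₂ < b ^ (-(1 / (2 * b))))
    {t₁ t₂ : ℝ} (ht₁ : 0 ≤ t₁) (ht₂ : 0 ≤ t₂)
    {θ₁ θ₂ : ℝ} (hθ : ∀ k : ℤ, θ₁ - θ₂ ≠ 2 * Real.pi * k) :
    ∃ C : ℝ, ∀ᶠ n : ℕ in atTop,
      ‖kernel b α r₁ r₂ n
        ((r₁ * (1 - t₁ / (sigma₁ b r₁ r₂ * n)) : ℝ) * Complex.exp (Complex.I * θ₁))
        ((r₁ * (1 - t₂ / (sigma₁ b r₁ r₂ * n)) : ℝ) * Complex.exp (Complex.I * θ₂))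
      - 2 * Real.pi * n * szegoReg b α r₁ r₂ n θ₁ θ₂
          * Complex.exp (Complex.I * ⌊jStar b α r₁ r₂ n⌋ * (θ₁ - θ₂))
          * (r₁ ^ (-2 * xFrac b α r₁ r₂ n) : ℝ)
          * (Real.exp (-t₁ - t₂) : ℝ)‖ ≤ C := by
  have hs := (sigma_pos hb hr₁ hr₁₂).1
  set ζ : ℂ := Complex.exp (Complex.I * (θ₁ - θ₂)) with hζdef
  have hζe : ζ = Complex.exp (Complex.I * (θ₁ - θ₂ : ℝ)) := by rw [hζdef]; push_cast; rfl
  have hζ : ‖ζ‖ = 1 := by rw [hζe]; exact norm_exp_I_mul _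
  have hζ1 : ζ ≠ 1 := by rw [hζe]; exact exp_I_mul_ne_one hθ
  set s := sigma₁ b r₁ r₂ with hsdef
  -- The `2` comes from `e^{-2τ} ≤ 1 - τ` for `τ ≤ 1/2`.
  set T := 2 * (t₁ + t₂) / s with hT
  have hT0 : 0 ≤ T := by positivity
  obtain ⟨C₀, hsum⟩ := scaled_sum_asymp hb hα hr₁ hr₁₂ hr₂ hζ hζ1 hT0
  obtain ⟨C₁, hC₁, hP₁⟩ := radialFactor_asymp (α := α) hb hr₁ hr₁₂ ht₁
  obtain ⟨C₂, hC₂, hP₂⟩ := radialFactor_asymp (α := α) hb hr₁ hr₁₂ ht₂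
  obtain ⟨B, hB0, hB⟩ := norm_regSum_le (α := α) hb hr₁ hr₁₂ hζ
  rw [← hsdef] at hP₁ hP₂
  refine ⟨r₁ ^ (-2 : ℝ) * s * ((1 + C₁) * (1 + C₂) * Real.exp T * C₀
    + (C₁ * (1 + C₂) + C₂) * B), ?_⟩
  have hcast := tendsto_natCast_atTop_atTop (R := ℝ)
  filter_upwards [eventually_ge_atTop 1, (tendsto_jStar (α := α) hb hr₁ hr₁₂).eventually_ge_atTop 0,
    hcast.eventually_ge_atTop (2 * t₁ / s), hcast.eventually_ge_atTop (2 * t₂ / s),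
    eventually_le_of_jStar (α := α) hb hr₁ hr₁₂ hr₂, hP₁, hP₂, hsum]
    with n hn hj hn1 hn2 hNn hP₁ hP₂ hsum
  have hn1' : (1 : ℝ) ≤ n := by exact_mod_cast hn
  have hn0 : (0 : ℝ) < n := by linarith
  obtain ⟨hNint, hN, -, -⟩ := floor_facts hj
  set N := ⌊jStar b α r₁ r₂ n⌋₊ with hNdef
  have hτ : ∀ t : ℝ, 2 * t / s ≤ n → t / (s * n) ≤ 1 / 2 := fun t ht => by
    rw [div_le_iff₀ hs] at ht
    rw [div_le_iff₀ (by positivity)]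
    linarith
  have hτ1 := hτ t₁ hn1
  have hτ2 := hτ t₂ hn2
  have hτ10 : 0 ≤ t₁ / (s * n) := by positivity
  have hτ20 : 0 ≤ t₂ / (s * n) := by positivity
  have hTn : T / n = 2 * (t₁ / (s * n)) + 2 * (t₂ / (s * n)) := by rw [hT]; field_simp
  rw [kernel_eq hb hα hr₁ hr₁₂ hn hτ10 (by linarith) hτ20 (by linarith), ← hζdef]
  set τ₁ := t₁ / (s * n) with hτ₁
  set τ₂ := t₂ / (s * n) with hτ₂
  set q := (1 - τ₁) * (1 - τ₂) with hq
  have hqexp : Real.exp (-(T / n)) ≤ q := by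
    rw [hTn, neg_add, Real.exp_add]
    exact mul_le_mul (exp_neg_two_mul_le hτ10 hτ1) (exp_neg_two_mul_le hτ20 hτ2)
      (Real.exp_pos _).le (by linarith)
  have hq1 : q ≤ 1 := mul_le_one₀ (by linarith) (by linarith) (by linarith)
  obtain ⟨hq0, -, hqQ⟩ := damping_facts hn hqexp hq1
  have hsum := hsum q hqexp hq1
  set A := ∑ i ∈ Finset.range n, (q * ζ) ^ i /
          ((innerScaled b α r₁ r₂ n (i + 1) + momentRatio b α r₁ r₂ n (i + 1) *
            outerScaled b α r₁ r₂ n (i + 1) : ℝ) : ℂ) with hA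
  have hsumA : ∑ j ∈ Finset.Icc 1 n, (q * ζ : ℂ) ^ (j - 1) /
            ((innerLaplace b (n * r₁ ^ (2 * b)) (j + α) +
              (r₂ / r₁) ^ (2 * ((j : ℝ) - jStar b α r₁ r₂ n)) *
                outerLaplace b (n * r₂ ^ (2 * b)) (j + α) : ℝ) : ℂ) = ((s * n : ℝ) : ℂ) * A := by
    rw [hA, Finset.mul_sum, ← Finset.Ico_add_one_right_eq_Icc, Finset.sum_Ico_eq_sum_range,
      Nat.add_sub_cancel]
    refine Finset.sum_congr rfl fun i _ => ?_
    rw [innerLaplace_add_eq hb hr₁ hr₁₂ hn, Nat.add_sub_cancel_left]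
    rw [show ((1 + i : ℕ) : ℝ) = i + 1 by push_cast; ring]
    push_cast
    rw [div_div_eq_mul_div]
    ring
  rw [hsumA, szegoReg_eq hb hr₁ hr₁₂ hθ n, ← hζdef, ← hsdef]
  set x := xFrac b α r₁ r₂ n with hx
  set g := regSum b α r₁ r₂ n ζ with hg
  have hζN : Complex.exp (Complex.I * ⌊jStar b α r₁ r₂ n⌋ * (θ₁ - θ₂)) = ζ ^ N := by
    rw [← hNint, hζdef, ← Complex.exp_nat_mul]; push_cast; ring_nf
  -- The dependence on `x` cancels, leaving the `r₁^{-2}` of `kernel_eq`.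
  have hr : s / r₁ ^ (2 * (1 - x)) * r₁ ^ (-2 * x) = r₁ ^ (-2 : ℝ) * s := by
    rw [div_mul_eq_mul_div, mul_div_assoc, ← Real.rpow_sub hr₁, mul_comm]
    ring_nf
  have hrc : ((s / r₁ ^ (2 * (1 - x)) : ℝ) : ℂ) * ((r₁ ^ (-2 * x) : ℝ) : ℂ) =
      ((r₁ ^ (-2 : ℝ) * s : ℝ) : ℂ) := by rw [← hr]; push_cast; rfl
  set D := radialFactor b α r₁ n τ₁ * radialFactor b α r₁ n τ₂ with hD
  have hpi : (Real.pi : ℂ) ≠ 0 := by exact_mod_cast Real.pi_pos.ne'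
  have hE : Real.exp (-t₁ - t₂) = Real.exp (-t₁) * Real.exp (-t₂) := by
    rw [← Real.exp_add]; ring_nf
  rw [hζN, hE]
  set e₁ := Real.exp (-t₁) with he₁
  set e₂ := Real.exp (-t₂) with he₂
  have he₁1 : e₁ ≤ 1 := Real.exp_le_one_iff.2 (by linarith)
  have he₂1 : e₂ ≤ 1 := Real.exp_le_one_iff.2 (by linarith)
  have he₁0 : 0 ≤ e₁ := (Real.exp_pos _).le
  have he₂0 : 0 ≤ e₂ := (Real.exp_pos _).le
  have hDq : D * q ^ N = (radialFactor b α r₁ n τ₁ * (1 - τ₁) ^ N) *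
      (radialFactor b α r₁ n τ₂ * (1 - τ₂) ^ N) := by
    rw [hD, hq, mul_pow]; ring
  set P₁ := radialFactor b α r₁ n τ₁ * (1 - τ₁) ^ N with hP₁def
  set P₂ := radialFactor b α r₁ n τ₂ * (1 - τ₂) ^ N with hP₂def
  have hbd : ∀ {P e C : ℝ}, 0 ≤ C → 0 ≤ e → e ≤ 1 → |P - e| ≤ C / n → |P| ≤ 1 + C := by
    intro P e C hC h0 h1 h
    have h2 : C / n ≤ C := div_le_self hC hn1'
    rw [abs_le] at h ⊢
    constructor <;> linarith [h.1, h.2]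
  have hP₁b := hbd hC₁ he₁0 he₁1 hP₁
  have hP₂b := hbd hC₂ he₂0 he₂1 hP₂
  have hΦ : |D * q ^ N - e₁ * e₂| ≤ (C₁ * (1 + C₂) + C₂) / n := by
    rw [hDq, show P₁ * P₂ - e₁ * e₂ = (P₁ - e₁) * P₂ + e₁ * (P₂ - e₂) by ring]
    refine (abs_add_le _ _).trans ?_
    rw [abs_mul _ P₂, abs_mul e₁, abs_of_nonneg he₁0]
    calc _ ≤ C₁ / n * (1 + C₂) + 1 * (C₂ / n) := by gcongr
      _ = _ := by ring
  -- Only `D q^N` has a known limit; dividing by `q^N`, which is at least `e^{-T}`, bounds `D`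
  -- itself.
  have hDb : |D| ≤ (1 + C₁) * (1 + C₂) * Real.exp T := by
    have h1 : D = D * q ^ N * q⁻¹ ^ N := by
      rw [inv_pow, mul_assoc, mul_inv_cancel₀ (by positivity), mul_one]
    rw [h1, hDq, abs_mul, abs_mul, abs_of_nonneg (by positivity : 0 ≤ q⁻¹ ^ N)]
    have := hqQ N hNn
    gcongr
  -- The difference separates into the error of the sum and the error of the radial factor. Both are
  -- `O(1/n)` and are multiplied by `n`.
  have hfin : (((r₁ ^ (-2 : ℝ) * D : ℝ) : ℂ) * (((s * n : ℝ) : ℂ) * A) -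
      2 * Real.pi * n * (1 / (2 * Real.pi) * ((s / r₁ ^ (2 * (1 - x)) : ℝ) : ℂ) * g) * ζ ^ N *
        ((r₁ ^ (-2 * x) : ℝ) : ℂ) * ((e₁ * e₂ : ℝ) : ℂ)) =
      ((r₁ ^ (-2 : ℝ) * s * n : ℝ) : ℂ) * ((D : ℂ) * (A - (q * ζ) ^ N * g) +
        ((D * q ^ N - e₁ * e₂ : ℝ) : ℂ) * ζ ^ N * g) := by
    have h1 : 2 * Real.pi * n * (1 / (2 * Real.pi) * ((s / r₁ ^ (2 * (1 - x)) : ℝ) : ℂ) * g) *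
        ζ ^ N * ((r₁ ^ (-2 * x) : ℝ) : ℂ) * ((e₁ * e₂ : ℝ) : ℂ) =
        (((s / r₁ ^ (2 * (1 - x)) : ℝ) : ℂ) * ((r₁ ^ (-2 * x) : ℝ) : ℂ)) * n * ζ ^ N *
          ((e₁ * e₂ : ℝ) : ℂ) * g := by
      field_simp
    rw [h1, hrc, mul_pow]
    push_cast
    ring
  rw [hfin, norm_mul, Complex.norm_real, Real.norm_of_nonneg (by positivity)]
  have hbound : ‖(D : ℂ) * (A - (q * ζ) ^ N * g) +
        ((D * q ^ N - e₁ * e₂ : ℝ) : ℂ) * ζ ^ N * g‖ ≤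
      ((1 + C₁) * (1 + C₂) * Real.exp T) * (C₀ / n) + (C₁ * (1 + C₂) + C₂) / n * B := by
    refine (norm_add_le _ _).trans (add_le_add ?_ ?_)
    · rw [norm_mul, Complex.norm_real, Real.norm_eq_abs]
      gcongr
    · rw [norm_mul, norm_mul, norm_pow, hζ, one_pow, mul_one, Complex.norm_real, Real.norm_eq_abs]
      gcongr
      exact hB n
  calc _ ≤ r₁ ^ (-2 : ℝ) * s * n * (((1 + C₁) * (1 + C₂) * Real.exp T) * (C₀ / n) +
        (C₁ * (1 + C₂) + C₂) / n * B) := by gcongr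
    _ = _ := by field_simp

end HardWall

theorem theorem4 (b α r₁ r₂ : ℝ) (hb : 0 < b) (hα : -1 < α)
    (hr₁ : 0 < r₁) (hr₁₂ : r₁ < r₂) (hr₂ : r₂ < b ^ (-(1 / (2 * b))))
    (t₁ t₂ : ℝ) (ht₁ : 0 ≤ t₁) (ht₂ : 0 ≤ t₂)
    (θ₁ θ₂ : ℝ) (hθ : ∀ k : ℤ, θ₁ - θ₂ ≠ 2 * Real.pi * k) :
    -- the Abel limit defining the regularized Szegő kernel exists for every `n`
    (∀ n : ℕ, Tendsto
      (fun r : ℝ => HardWall.szego b α r₁ r₂ n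
        (r * Complex.exp (Complex.I * θ₁)) (r * Complex.exp (Complex.I * θ₂)))
      (𝓝[>] r₁) (𝓝 (HardWall.szegoReg b α r₁ r₂ n θ₁ θ₂))) ∧
    -- and is given by the absolutely convergent expression below
    (∀ n : ℕ, HardWall.szegoReg b α r₁ r₂ n θ₁ θ₂ =
      1 / (2 * Real.pi) *
        ((HardWall.sigma₁ b r₁ r₂ / r₁ ^ (2 * (1 - HardWall.xFrac b α r₁ r₂ n)) : ℝ) : ℂ) *
        (1 / (Complex.exp (Complex.I * (θ₁ - θ₂)) - 1)
          + ∑' l : ℕ, Complex.exp (Complex.I * (θ₁ - θ₂) * l) /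
              ((1 + HardWall.sigma₁ b r₁ r₂ / HardWall.sigma₂ b r₁ r₂ *
                (r₂ / r₁) ^ (2 * ((l : ℝ) + 1 - HardWall.xFrac b α r₁ r₂ n)) : ℝ) : ℂ)
          -- the terms with index `-(l + 1)`, where `l` runs over the natural numbers
          - ∑' l : ℕ, Complex.exp (Complex.I * (θ₁ - θ₂) * (-((l : ℂ) + 1))) /
              ((1 + HardWall.sigma₂ b r₁ r₂ / HardWall.sigma₁ b r₁ r₂ *
                (r₁ / r₂) ^ (2 * (-((l : ℝ) + 1) + 1 - HardWall.xFrac b α r₁ r₂ n)) : ℝ)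
                  : ℂ))) ∧
    -- asymptotics of the correlation kernel
    (fun n : ℕ =>
      HardWall.kernel b α r₁ r₂ n
        ((r₁ * (1 - t₁ / (HardWall.sigma₁ b r₁ r₂ * n)) : ℝ) * Complex.exp (Complex.I * θ₁))
        ((r₁ * (1 - t₂ / (HardWall.sigma₁ b r₁ r₂ * n)) : ℝ) * Complex.exp (Complex.I * θ₂))
      - 2 * Real.pi * n * HardWall.szegoReg b α r₁ r₂ n θ₁ θ₂
          * Complex.exp (Complex.I * ⌊HardWall.jStar b α r₁ r₂ n⌋ * (θ₁ - θ₂))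
          * (r₁ ^ (-2 * HardWall.xFrac b α r₁ r₂ n) : ℝ)
          * (Real.exp (-t₁ - t₂) : ℝ))
      =O[atTop] fun n : ℕ => Real.sqrt (n * Real.log n) := by
  refine ⟨fun n => ?_, fun n => ?_, ?_⟩
  · rw [HardWall.szegoReg_eq hb hr₁ hr₁₂ hθ n]
    exact HardWall.tendsto_szego hb hr₁ hr₁₂ hθ n
  · rw [HardWall.szegoReg_eq hb hr₁ hr₁₂ hθ n, HardWall.regSum_eq hr₁ hr₁₂]
  · obtain ⟨C, hC⟩ := HardWall.kernel_sub_eventually_bounded hb hα hr₁ hr₁₂ hr₂ ht₁ ht₂ hθ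
    refine IsBigO.of_bound C ?_
    filter_upwards [hC, eventually_ge_atTop 3] with n hn hn3
    have h1 := HardWall.one_le_sqrt_mul_log hn3
    rw [Real.norm_of_nonneg (Real.sqrt_nonneg _)]
    exact hn.trans (le_mul_of_one_le_right ((norm_nonneg _).trans hn) h1)
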